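/- Consider $N$ qubits labelled by $[N]=\{1,\dots,N\}$, a subset $A\subsetneq[N]$ of measured qubits with complement $B=[N]\setminus A$, a set $\varnothing\neq s\subseteq B$, and a unit vector $|\Psi\rangle\in(\mathbb{C}^2)^{\otimes N}=\mathcal H_A\otimes\mathcal H_B$. For a state $|\varphi\rangle\in\mathcal H_B$ the concentratable entanglement with respect to $s$ is $\mathrm{CE}(|\varphi\rangle)=1-2^{-|s|}\sum_{\gamma\subseteq s}\operatorname{tr}(\varphi_\gamma^2)$, where $\varphi_\gamma$ is the reduced state of $|\varphi\rangle\langle\varphi|$ on the qubits in $\gamma$. For a real-valued function $E$ on states of $\mathcal H_B$, the localizable entanglement is $$L^{E}(|\Psi\rangle)=\max_{\{|e_k\rangle\}}\ \sum_{k}p_k\,E(|\varphi_k\rangle),\qquad p_k=\big\|(\langle e_k|_A\otimes I_B)|\Psi\rangle\big\|^2,\quad |\varphi_k\rangle=p_k^{-1/2}(\langle e_k|_A\otimes I_B)|\Psi\rangle ,$$ where terms with $p_k=0$ count as $0$ and the maximum is over all orthonormal bases $\{|e_k\rangle\}$ of $\mathcal H_A$ each of whose elements is a product vector $\bigotimes_{a\in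 A}|v_a\rangle$ (that is, over all rank-one projective measurements on $A$ whose projectors have tensor product form). For $i\neq j\in B$ and $\vec a,\vec b\in\mathbb{R}^3$ put $$Q^{ij}_{\vec a,\vec b}(|\Psi\rangle)=\langle\Psi|(\vec a\cdot\vec\sigma^{(i)})\otimes(\vec b\cdot\vec\sigma^{(j)})|\Psi\rangle-\langle\Psi|\vec a\cdot\vec\sigma^{(i)}|\Psi\rangle\,\langle\Psi|\vec b\cdot\vec\sigma^{(j)}|\Psi\rangle ,$$ where $\vec\sigma^{(i)}$ is the vector of Pauli matrices acting on qubit $i$, and let $\mathbf Q^{ij}(|\Psi\rangle)$ be the real $3\times3$ matrix with entries $Q^{ij}_{\hat e_p,\hat e_q}(|\Psi\rangle)$. Theorem. The maxima defining $L^{\mathrm{CE}}(|\Psi\rangle)$ and $L^{\sqrt{\mathrm{CE}}}(|\Psi\rangle)$ are attained, and $$\sqrt{L^{\mathrm{CE}}(|\Psi\rangle)}\ \ge\ L^{\sqrt{\mathrm{CE}}}(|\Psi\rangle)\ \ge\ \frac12\max_{\substack{i\neq j\in s\\ \hat a,\hat b\in S^2}}\big|Q^{ij}_{\hat a,\hat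 b}(|\Psi\rangle)\big| ,$$ where $S^2$ is the unit sphere of $\mathbb{R}^3$ and the maximum on the right is read as $0$ if $|s|=1$. Moreover, for all $i\neq j\in s$, the maximum $\max_{\hat a,\hat b\in S^2}|Q^{ij}_{\hat a,\hat b}(|\Psi\rangle)|$ exists and equals the largest singular value of $\mathbf Q^{ij}(|\Psi\rangle)$; hence, if $|s|\ge2$, the maximum on the right-hand side of the display exists and equals the largest singular value of $\mathbf Q^{ij}(|\Psi\rangle)$ for an optimal pair $i\neq j\in s$. -/

import Mathlib

noncomputable section

/-- The Hilbert space `⨂_{k ∈ κ} ℂ²` of a family of qubits labelled by `κ`, written in the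
computational basis (a basis vector is a bit assignment `κ → Fin 2`). -/
abbrev Qubits (κ : Type*) [Fintype κ] : Type _ := EuclideanSpace ℂ (κ → Fin 2)

section States

variable {κ : Type*} [Fintype κ] [DecidableEq κ]

/-- Glue a bit assignment on `γ` and one on the complement of `γ`. -/
def glue (γ : Finset κ) (x : {i // i ∈ γ} → Fin 2) (z : {i // i ∉ γ} → Fin 2) : κ → Fin 2 :=
  fun i => if h : i ∈ γ then x ⟨i, h⟩ else z ⟨i, h⟩

/-- The reduced state `ψ_γ` of `|ψ⟩⟨ψ|` on the qubits in `γ` (partial trace over the others). -/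
def reducedState (ψ : Qubits κ) (γ : Finset κ) :
    Matrix ({i // i ∈ γ} → Fin 2) ({i // i ∈ γ} → Fin 2) ℂ :=
  fun x x' => ∑ z : {i // i ∉ γ} → Fin 2, ψ (glue γ x z) * star (ψ (glue γ x' z))

/-- The purity `tr (ψ_γ ^ 2)`; the trace is real because `ψ_γ` is Hermitian. -/
def purity (ψ : Qubits κ) (γ : Finset κ) : ℝ := ((reducedState ψ γ) ^ 2).trace.re

/-- The concentratable entanglement `1 - 2 ^ (-|s|) ∑_{γ ⊆ s} tr (ψ_γ ^ 2)`. -/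
def concentratableEntanglement (s : Finset κ) (ψ : Qubits κ) : ℝ :=
  1 - (1 / 2 ^ s.card) * ∑ γ ∈ s.powerset, purity ψ γ

/-- The square root of the concentratable entanglement. -/
def sqrtCE (s : Finset κ) (ψ : Qubits κ) : ℝ := √(concentratableEntanglement s ψ)

/-- `f` is a product vector `⨂_k v_k`. -/
def IsProductVector (f : Qubits κ) : Prop :=
  ∃ v : κ → EuclideanSpace ℂ (Fin 2), ∀ x : κ → Fin 2, f x = ∏ k, v k (x k)

end States

section Localization

variable {κ : Type*} [Fintype κ] [DecidableEq κ]

/-- The unnormalized post-measurement vector `(⟨f|_A ⊗ I_B) |Ψ⟩` on the complement `B` of `A`. -/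
def postVector (A : Finset κ) (f : Qubits {i // i ∈ A}) (Ψ : Qubits κ) : Qubits {i // i ∉ A} :=
  WithLp.toLp 2 fun y => ∑ x : {i // i ∈ A} → Fin 2, star (f x) * Ψ (glue A x y)

/-- The average `∑_k p_k E(φ_k)` of `E` over the ensemble produced by the rank-one projective
measurement of `Ψ` on `A` in the orthonormal basis `e`:
`p_k = ‖(⟨e_k|_A ⊗ I_B) Ψ‖ ^ 2` and `φ_k` is the normalized post-measurement state. -/
def averageEntanglement (A : Finset κ) (E : Qubits {i // i ∉ A} → ℝ) (Ψ : Qubits κ)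
    (e : OrthonormalBasis ({i // i ∈ A} → Fin 2) ℂ (Qubits {i // i ∈ A})) : ℝ :=
  ∑ k, ‖postVector A (e k) Ψ‖ ^ 2 *
    E ((‖postVector A (e k) Ψ‖ : ℂ)⁻¹ • postVector A (e k) Ψ)

/-- The averages of `E` attained by the local measurements on `A`, that is, by the rank-one
projective measurements on `A` all of whose projectors have tensor product form. -/
def localAverages (A : Finset κ) (E : Qubits {i // i ∉ A} → ℝ) (Ψ : Qubits κ) : Set ℝ :=
  {r | ∃ e : OrthonormalBasis ({i // i ∈ A} → Fin 2) ℂ (Qubits {i // i ∈ A}),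
    (∀ k, IsProductVector (e k)) ∧ r = averageEntanglement A E Ψ e}

/-- The localizable multipartite entanglement `L^E(Ψ)` with measured systems `A`. -/
def localizableEntanglement (A : Finset κ) (E : Qubits {i // i ∉ A} → ℝ) (Ψ : Qubits κ) : ℝ :=
  sSup (localAverages A E Ψ)

end Localization

section Correlation

variable {κ : Type*} [Fintype κ] [DecidableEq κ]

/-- The Pauli matrices. -/
def pauli : Fin 3 → Matrix (Fin 2) (Fin 2) ℂ :=
  ![!![0, 1; 1, 0], !![0, -Complex.I; Complex.I, 0], !![1, 0; 0, -1]]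

/-- The spin observable `a · σ` of a single qubit. -/
def spin (a : EuclideanSpace ℝ (Fin 3)) : Matrix (Fin 2) (Fin 2) ℂ :=
  ∑ k, (a k : ℂ) • pauli k

/-- The tensor product `⨂_k M_k` of single-qubit operators. -/
def tensorOp (M : κ → Matrix (Fin 2) (Fin 2) ℂ) : Matrix (κ → Fin 2) (κ → Fin 2) ℂ :=
  fun x y => ∏ k, M k (x k) (y k)

/-- The expectation value `⟨Ψ| X |Ψ⟩` of a Hermitian operator `X`. -/
def expectation (Ψ : Qubits κ) (X : Matrix (κ → Fin 2) (κ → Fin 2) ℂ) : ℝ :=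
  (∑ x, star (Ψ x) * (X.mulVec (fun y => Ψ y)) x).re

/-- The connected two-point spin correlation function `Q^{ij}_{a,b}(Ψ)` (for `i ≠ j`). -/
def spinCorrelation (Ψ : Qubits κ) (i j : κ) (a b : EuclideanSpace ℝ (Fin 3)) : ℝ :=
  expectation Ψ (tensorOp (Function.update (Function.update (fun _ => 1) i (spin a)) j (spin b)))
    - expectation Ψ (tensorOp (Function.update (fun _ => 1) i (spin a)))
      * expectation Ψ (tensorOp (Function.update (fun _ => 1) j (spin b)))

/-- The `3 × 3` correlation matrix `(Q^{ij})_{pq} = Q^{ij}_{e_p,e_q}`. -/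
def correlationMatrix (Ψ : Qubits κ) (i j : κ) : Matrix (Fin 3) (Fin 3) ℝ :=
  fun p q => spinCorrelation Ψ i j (EuclideanSpace.single p 1) (EuclideanSpace.single q 1)

/-- The largest singular value of a real `3 × 3` matrix (singular values are listed in
decreasing order, starting from index `0`). -/
def maxSingularValue (M : Matrix (Fin 3) (Fin 3) ℝ) : ℝ :=
  (Matrix.toEuclideanLin M).singularValues 0

/-- The values `|Q^{ij}_{a,b}(Ψ)|` for fixed `i, j` and unit vectors `a, b`. -/
def pairCorrelations (Ψ : Qubits κ) (i j : κ) : Set ℝ :=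
  {r | ∃ a b : EuclideanSpace ℝ (Fin 3), ‖a‖ = 1 ∧ ‖b‖ = 1 ∧ r = |spinCorrelation Ψ i j a b|}

/-- The values `|Q^{ij}_{a,b}(Ψ)|` for distinct `i, j` in `s` and unit vectors `a, b`. -/
def allCorrelations (Ψ : Qubits κ) (s : Set κ) : Set ℝ :=
  {r | ∃ i ∈ s, ∃ j ∈ s, i ≠ j ∧ r ∈ pairCorrelations Ψ i j}

/-- The maximum of `|Q^{ij}_{a,b}(Ψ)|` over distinct `i, j` in `s` and unit vectors `a, b`
(zero if `s` has no two distinct elements). -/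
def maxCorrelation (Ψ : Qubits κ) (s : Set κ) : ℝ := sSup (allCorrelations Ψ s)

end Correlation

end

/-! The upper inequality is Jensen's: the square of a mean is at most the mean of the squares, and
the outcome probabilities sum to 1. Both maxima are attained because the local bases are
parametrised by a compact set of unit vectors on which the average is continuous
(`isCompact_localAverages`).

The lower bound combines a choice of measurement with a bound for pure states. Let X and Y be the
spins of qubits i and j. A traceless Hermitian matrix has zero diagonal in some product basis
(`exists_product_family_zero_diag`); applied to the matrix on A induced by X - ⟨X⟩, this gives a
local measurement for which ⟨X⟩ is the same after every outcome of nonzero probability. Averages of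
⟨XY⟩ and ⟨Y⟩ are always preserved, so for this measurement the average covariance of the outcomes is
exactly that of Ψ, and the triangle inequality reduces the claim to |Q| / 2 ≤ √CE for a single pure
state φ.

For the latter, Q² ≤ 2 (1 - tr φ_i²) (`spinCorrelation_sq_le`): split φ along the two eigenvectors
of X, and note that a symmetric contraction separates two vectors only as far as their overlap
permits. On the other side, (1 - tr φ_i²) / 2 ≤ CE (`one_sub_purity_singleton_le`), by writing
purities as expectations of partial swaps on φ ⊗ φ.

The singular value statement holds because Q is the bilinear form of the correlation matrix. -/

noncomputable section

set_option linter.unusedSectionVars false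

/-! ### Splitting a register into two parts -/

section Glue

variable {κ : Type*} [Fintype κ] [DecidableEq κ]

lemma sum_glue {M : Type*} [AddCommMonoid M] (γ : Finset κ) (f : (κ → Fin 2) → M) :
    ∑ w, f w = ∑ x : {i // i ∈ γ} → Fin 2, ∑ z : {i // i ∉ γ} → Fin 2, f (glue γ x z) := by
  rw [← Fintype.sum_prod_type']
  exact (Equiv.sum_comp (Equiv.piEquivPiSubtypeProd (fun i => i ∈ γ) (fun _ => Fin 2)).symm f).symm

@[simp] lemma glue_val_mem (γ : Finset κ) (x : {i // i ∈ γ} → Fin 2) (z : {i // i ∉ γ} → Fin 2)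
    (i : {i // i ∈ γ}) : glue γ x z i = x i := by
  simp [glue]

@[simp] lemma glue_val_notMem (γ : Finset κ) (x : {i // i ∈ γ} → Fin 2)
    (z : {i // i ∉ γ} → Fin 2) (i : {i // i ∉ γ}) : glue γ x z i = z i := by
  simp [glue, i.2]

lemma tensorOp_glue (M : κ → Matrix (Fin 2) (Fin 2) ℂ) (γ : Finset κ)
    (x x' : {i // i ∈ γ} → Fin 2) (z z' : {i // i ∉ γ} → Fin 2) :
    tensorOp M (glue γ x z) (glue γ x' z') =
      tensorOp (fun k : {i // i ∈ γ} => M k) x x' * tensorOp (fun k : {i // i ∉ γ} => M k) z z' := by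
  unfold tensorOp
  rw [← Fintype.prod_subtype_mul_prod_subtype (fun i => i ∈ γ)]
  simp only [glue_val_mem, glue_val_notMem]
  congr!

lemma tensorOp_one : tensorOp (fun _ : κ => (1 : Matrix (Fin 2) (Fin 2) ℂ)) = 1 := by
  ext x y
  simp only [tensorOp, Matrix.one_apply]
  rw [Finset.prod_ite_zero]
  simp [funext_iff]

end Glue

/-! ### Purities as swap expectations, and a lower bound for CE -/

section Swap

variable {κ : Type*} [Fintype κ] [DecidableEq κ]

/-- Exchange the bits in `γ` between the two copies of a doubled register. -/
def swapBits (γ : Finset κ) (w : (κ → Fin 2) × (κ → Fin 2)) : (κ → Fin 2) × (κ → Fin 2) :=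
  (fun k => if k ∈ γ then w.2 k else w.1 k, fun k => if k ∈ γ then w.1 k else w.2 k)

lemma swapBits_involutive (γ : Finset κ) : Function.Involutive (swapBits γ) := by
  rintro ⟨x, y⟩
  simp only [swapBits, Prod.mk.injEq]
  constructor <;> funext k <;> by_cases h : k ∈ γ <;> simp [h]

lemma sum_swapBits {M : Type*} [AddCommMonoid M] (γ : Finset κ)
    (f : (κ → Fin 2) × (κ → Fin 2) → M) : ∑ w, f (swapBits γ w) = ∑ w, f w :=
  Equiv.sum_comp (swapBits_involutive γ).toPerm f

lemma swapBits_empty (w : (κ → Fin 2) × (κ → Fin 2)) : swapBits ∅ w = w := by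
  simp [swapBits]

lemma swapBits_singleton_swapBits {γ : Finset κ} {i : κ} (hi : i ∉ γ)
    (w : (κ → Fin 2) × (κ → Fin 2)) : swapBits {i} (swapBits γ w) = swapBits (insert i γ) w := by
  simp only [swapBits, Prod.mk.injEq]
  constructor <;> funext k <;> by_cases h : k = i <;> by_cases h' : k ∈ γ <;> simp_all

lemma swapBits_swapBits_singleton {γ : Finset κ} {i : κ} (hi : i ∉ γ)
    (w : (κ → Fin 2) × (κ → Fin 2)) : swapBits γ (swapBits {i} w) = swapBits (insert i γ) w := by
  simp only [swapBits, Prod.mk.injEq]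
  constructor <;> funext k <;> by_cases h : k = i <;> by_cases h' : k ∈ γ <;> simp_all

/-- Two copies of a pure state. -/
def twoCopies (ψ : Qubits κ) (w : (κ → Fin 2) × (κ → Fin 2)) : ℂ := ψ w.1 * ψ w.2

/-- The swap trick: the purity of γ is the expectation in ψ ⊗ ψ of the operator exchanging the
γ-bits of the two copies. All later purity estimates use this form. -/
lemma trace_reducedState_sq (ψ : Qubits κ) (γ : Finset κ) :
    ((reducedState ψ γ) ^ 2).trace =
      ∑ w, star (twoCopies ψ (swapBits γ w)) * twoCopies ψ w := by
  have h1 : ∀ x x' z z', swapBits γ (glue γ x z, glue γ x' z') = (glue γ x' z, glue γ x z') := by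
    intro x x' z z'
    simp only [swapBits, Prod.mk.injEq]
    constructor <;> funext k <;> by_cases h : k ∈ γ <;> simp [glue, h]
  rw [Fintype.sum_prod_type, sum_glue γ]
  simp_rw [sum_glue γ (fun y => star (twoCopies ψ (swapBits γ (_, y))) * twoCopies ψ (_, y)), h1]
  simp only [pow_two, Matrix.trace, Matrix.diag, Matrix.mul_apply, reducedState, twoCopies]
  refine Finset.sum_congr rfl fun x _ => ?_
  rw [Finset.sum_comm]
  refine Finset.sum_congr rfl fun x' _ => ?_
  rw [Finset.sum_mul_sum]
  refine Finset.sum_congr rfl fun z _ => Finset.sum_congr rfl fun z' _ => ?_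
  simp only [star_mul']
  ring

/-- A partial swap permutes basis vectors, hence preserves norms; 2 Re(ā b) ≤ |a|² + |b|² summed
over all entries gives the bound. -/
lemma re_sum_star_swapBits_mul_le (γ : Finset κ) (G : (κ → Fin 2) × (κ → Fin 2) → ℂ) :
    (∑ w, star (G (swapBits γ w)) * G w).re ≤ (∑ w, star (G w) * G w).re := by
  have h : ∀ a b : ℂ, 2 * (star a * b).re ≤ (star a * a).re + (star b * b).re := by
    intro a b
    simp only [RCLike.star_def, Complex.mul_re, Complex.conj_re, Complex.conj_im]
    nlinarith [sq_nonneg (a.re - b.re), sq_nonneg (a.im - b.im)]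
  have h2 : 2 * (∑ w, star (G (swapBits γ w)) * G w).re ≤
      (∑ w, star (G (swapBits γ w)) * G (swapBits γ w)).re + (∑ w, star (G w) * G w).re := by
    simp only [Complex.re_sum]
    rw [Finset.mul_sum, ← Finset.sum_add_distrib]
    exact Finset.sum_le_sum fun w _ => h _ _
  rw [sum_swapBits γ (fun w => star (G w) * G w)] at h2
  linarith

lemma purity_empty (ψ : Qubits κ) (hψ : ‖ψ‖ = 1) : purity ψ ∅ = 1 := by
  rw [purity, trace_reducedState_sq]
  have h : ∑ x, star (ψ x) * ψ x = 1 := by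
    have := EuclideanSpace.norm_sq_eq ψ
    rw [hψ] at this
    have h3 : ∀ x, star (ψ x) * ψ x = ((‖ψ x‖ ^ 2 : ℝ) : ℂ) := by
      intro x
      rw [RCLike.star_def, mul_comm, Complex.mul_conj, Complex.normSq_eq_norm_sq]
    simp_rw [h3]
    rw [← Complex.ofReal_sum, ← this]
    simp
  simp_rw [swapBits_empty, twoCopies, star_mul', mul_mul_mul_comm]
  rw [Fintype.sum_prod_type]
  dsimp only
  rw [← Finset.sum_mul_sum, h]
  simp

lemma purity_le_one (ψ : Qubits κ) (hψ : ‖ψ‖ = 1) (γ : Finset κ) : purity ψ γ ≤ 1 := by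
  rw [← purity_empty ψ hψ, purity, purity, trace_reducedState_sq, trace_reducedState_sq]
  simp_rw [swapBits_empty]
  exact re_sum_star_swapBits_mul_le γ _

/-- The sum is a swap expectation in the symmetrised vector (1 + SWAP_i) ψ ⊗ ψ. Since SWAP_i is an
involution commuting with SWAP_γ, the four terms agree in pairs, whence the factor 2. -/
lemma purity_add_purity_insert (ψ : Qubits κ) {γ : Finset κ} {i : κ} (hi : i ∉ γ) :
    2 * (purity ψ γ + purity ψ (insert i γ)) =
      (∑ w, star (twoCopies ψ (swapBits γ w) + twoCopies ψ (swapBits {i} (swapBits γ w))) *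
        (twoCopies ψ w + twoCopies ψ (swapBits {i} w))).re := by
  have h1 : ∑ w, star (twoCopies ψ (swapBits γ w)) * twoCopies ψ (swapBits {i} w) =
      ∑ w, star (twoCopies ψ (swapBits (insert i γ) w)) * twoCopies ψ w := by
    rw [← sum_swapBits {i}]
    simp_rw [swapBits_involutive {i} _, swapBits_swapBits_singleton hi]
  have h2 : ∑ w, star (twoCopies ψ (swapBits (insert i γ) w)) * twoCopies ψ (swapBits {i} w) =
      ∑ w, star (twoCopies ψ (swapBits γ w)) * twoCopies ψ w := by
    rw [← sum_swapBits {i}]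
    simp_rw [← swapBits_swapBits_singleton hi, swapBits_involutive {i} _]
  simp_rw [swapBits_singleton_swapBits hi, star_add, add_mul, mul_add, Finset.sum_add_distrib]
  rw [h1, h2, purity, purity, trace_reducedState_sq, trace_reducedState_sq]
  simp only [Complex.add_re]
  ring

/-- The swap bound applied to (1 + SWAP_i) ψ ⊗ ψ; the squared norm of that vector is the previous
identity at γ = ∅. -/
lemma purity_add_purity_insert_le (ψ : Qubits κ) (hψ : ‖ψ‖ = 1) {γ : Finset κ} {i : κ}
    (hi : i ∉ γ) : purity ψ γ + purity ψ (insert i γ) ≤ 1 + purity ψ {i} := by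
  have h := purity_add_purity_insert ψ hi
  have h0 := purity_add_purity_insert ψ (Finset.notMem_empty i)
  rw [purity_empty ψ hψ] at h0
  simp_rw [swapBits_empty] at h0
  have := re_sum_star_swapBits_mul_le γ
    (fun w => twoCopies ψ w + twoCopies ψ (swapBits {i} w))
  simp only [insert_empty_eq] at h0
  linarith

lemma concentratableEntanglement_nonneg (s : Finset κ) (ψ : Qubits κ) (hψ : ‖ψ‖ = 1) :
    0 ≤ concentratableEntanglement s ψ := by
  have h : ∑ γ ∈ s.powerset, purity ψ γ ≤ 2 ^ s.card := by
    refine (Finset.sum_le_sum fun γ _ => purity_le_one ψ hψ γ).trans ?_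
    simp
  rw [concentratableEntanglement, sub_nonneg, one_div, inv_mul_le_iff₀ (by positivity)]
  simpa using h

/-- The subsets of s pair up as γ, γ ∪ {i} with i ∉ γ. Each of the 2^(|s|-1) pairs contributes at
most 1 + tr ψ_i². -/
lemma one_sub_purity_singleton_le (s : Finset κ) (ψ : Qubits κ) (hψ : ‖ψ‖ = 1) {i : κ}
    (hi : i ∈ s) : (1 - purity ψ {i}) / 2 ≤ concentratableEntanglement s ψ := by
  obtain ⟨t, hit, rfl⟩ : ∃ t, i ∉ t ∧ insert i t = s :=
    ⟨s.erase i, Finset.notMem_erase i s, Finset.insert_erase hi⟩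
  have h : ∑ γ ∈ (insert i t).powerset, purity ψ γ ≤ 2 ^ t.card * (1 + purity ψ {i}) := by
    rw [Finset.sum_powerset_insert hit, ← Finset.sum_add_distrib]
    refine (Finset.sum_le_sum fun γ hγ => purity_add_purity_insert_le ψ hψ
      fun hmem => hit (Finset.mem_powerset.1 hγ hmem)).trans ?_
    simp [mul_add]
  rw [concentratableEntanglement, Finset.card_insert_of_notMem hit, pow_succ]
  have h2 : (1 / (2 ^ t.card * 2)) * ∑ γ ∈ (insert i t).powerset, purity ψ γ ≤
      (1 + purity ψ {i}) / 2 := by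
    rw [one_div, inv_mul_le_iff₀ (by positivity)]
    linarith
  linarith

end Swap

/-! ### Product bases in which a traceless Hermitian matrix has zero diagonal -/

section ProductBasis

lemma exists_phase_mul_re_eq_zero (z : ℂ) : ∃ ω : ℂ, star ω * ω = 1 ∧ (z * ω).re = 0 := by
  by_cases hz : z = 0
  · exact ⟨1, by simp, by simp [hz]⟩
  · have hn : (‖z‖ : ℂ) ≠ 0 := by simpa using hz
    have h : z * star z = (‖z‖ : ℂ) ^ 2 := by
      rw [RCLike.star_def, Complex.mul_conj, Complex.normSq_eq_norm_sq]
      simp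
    refine ⟨Complex.I * star z / ‖z‖, ?_, ?_⟩
    · have : star (Complex.I * star z / (‖z‖ : ℂ)) = -Complex.I * z / ‖z‖ := by simp
      rw [this, div_mul_div_comm, show -Complex.I * z * (Complex.I * star z) =
        -(Complex.I * Complex.I) * (z * star z) by ring, h, Complex.I_mul_I]
      field_simp
    · rw [show z * (Complex.I * star z / ‖z‖) = (z * star z) * Complex.I / ‖z‖ by ring, h,
        show (‖z‖ : ℂ) ^ 2 * Complex.I / ‖z‖ = (‖z‖ : ℂ) * Complex.I by field_simp]
      simp

/-- The basis is (1, ±ω)/√2. Each diagonal entry is half the trace plus or minus Re(K₀₁ ω), and the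
phase ω is chosen to make K₀₁ ω purely imaginary. -/
lemma exists_orthonormal_pair_zero_diag (K : Matrix (Fin 2) (Fin 2) ℂ) (hK : K.IsHermitian)
    (htr : (K 0 0 + K 1 1).re = 0) :
    ∃ p : Fin 2 → Fin 2 → ℂ, (∀ b b', ∑ t, star (p b t) * p b' t = if b = b' then 1 else 0) ∧
      ∀ b, (∑ t, ∑ t', star (p b t) * K t t' * p b t').re = 0 := by
  obtain ⟨ω, hω, hre⟩ := exists_phase_mul_re_eq_zero (K 0 1)
  have hr : ((√2 : ℝ) : ℂ) ^ 2 = 2 := by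
    rw [← Complex.ofReal_pow, Real.sq_sqrt (by norm_num)]; simp
  have hr0 : ((√2 : ℝ) : ℂ) ≠ 0 := by
    intro h; rw [h] at hr; norm_num at hr
  have h10 : K 1 0 = star (K 0 1) := (hK.apply 1 0).symm
  have key : ∀ ε : ℂ, star ε = ε → ε * ε = 1 → (ε = 1 ∨ ε = -1) →
      (K 0 0 / 2 + K 0 1 * (ε * ω) / 2 + (star (ε * ω) * K 1 0) / 2 + K 1 1 / 2).re = 0 := by
    intro ε h1 h2 h3
    have h4 : (star (ε * ω) * K 1 0).re = (K 0 1 * (ε * ω)).re := by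
      rw [h10, ← star_mul']
      rw [RCLike.star_def, Complex.conj_re, mul_comm]
    have h5 : (K 0 1 * (ε * ω)).re = 0 := by
      rcases h3 with rfl | rfl
      · simpa using hre
      · have : K 0 1 * (-1 * ω) = -(K 0 1 * ω) := by ring
        rw [this, Complex.neg_re, hre, neg_zero]
    rw [h5] at h4
    simp only [Complex.add_re] at htr ⊢
    simp only [show (2 : ℂ) = ((2 : ℝ) : ℂ) by simp, Complex.div_ofReal_re, h4, h5]
    linarith
  refine ⟨![![1 / (√2 : ℝ), ω / (√2 : ℝ)], ![1 / (√2 : ℝ), -ω / (√2 : ℝ)]], ?_, ?_⟩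
  · have hω' : (starRingEnd ℂ) ω * ω = 1 := hω
    intro b b'
    fin_cases b <;> fin_cases b' <;> simp [Fin.sum_univ_two] <;> field_simp <;> rw [hr] <;>
      first | linear_combination hω' | linear_combination -hω'
  · have hω' : (starRingEnd ℂ) ω * ω = 1 := hω
    intro b
    fin_cases b
    · refine Eq.trans ?_ (key 1 (by simp) (by simp) (by simp))
      congr 1
      simp [Fin.sum_univ_two]
      field_simp
      rw [hr]
      linear_combination (2 * K 1 1) * hω'
    · refine Eq.trans ?_ (key (-1) (by simp) (by simp) (by simp))
      congr 1
      simp [Fin.sum_univ_two]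
      field_simp
      rw [hr]
      linear_combination (2 * K 1 1) * hω'

lemma sum_fin_cons {M : Type*} [AddCommMonoid M] {n : ℕ} (f : (Fin (n + 1) → Fin 2) → M) :
    ∑ w, f w = ∑ t : Fin 2, ∑ x : Fin n → Fin 2, f (Fin.cons t x) := by
  rw [← Fintype.sum_prod_type']
  exact (Equiv.sum_comp (Fin.consEquiv (fun _ : Fin (n + 1) => Fin 2)) f).symm

/-- A Hermitian matrix of trace zero on `n` qubits has zero diagonal in some orthonormal basis of
product vectors (obtained by measuring the qubits one after another). -/
lemma exists_product_family_zero_diag (n : ℕ) (G : Matrix (Fin n → Fin 2) (Fin n → Fin 2) ℂ)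
    (hG : G.IsHermitian) (htr : (∑ x, G x x).re = 0) :
    ∃ V : (Fin n → Fin 2) → Fin n → Fin 2 → ℂ,
      (∀ k k', ∑ x : Fin n → Fin 2, star (∏ l, V k l (x l)) * ∏ l, V k' l (x l) =
        if k = k' then 1 else 0) ∧
      ∀ k, (∑ x : Fin n → Fin 2, ∑ x' : Fin n → Fin 2,
        star (∏ l, V k l (x l)) * G x x' * ∏ l, V k l (x' l)).re = 0 := by
  induction n with
  | zero =>
    refine ⟨fun _ _ _ => 1, ?_, ?_⟩
    · intro k k'
      simp [Subsingleton.elim k k']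
    · intro k
      simpa using htr
  | succ n ih =>
    -- The first qubit is handled through the partial trace of `G` over the others. Its zero
    -- diagonal entry for outcome b says that the conditional matrix used in `step` is again
    -- traceless, as the induction requires.
    obtain ⟨p, hp, hp0⟩ := exists_orthonormal_pair_zero_diag
      (fun t t' => ∑ x : Fin n → Fin 2, G (Fin.cons t x) (Fin.cons t' x))
      (by
        refine Matrix.IsHermitian.ext fun t t' => ?_
        rw [star_sum]
        exact Finset.sum_congr rfl fun x _ => hG.apply _ _)
      (by
        rw [sum_fin_cons, Fin.sum_univ_two] at htr
        exact htr)
    have step : ∀ b, ∃ V : (Fin n → Fin 2) → Fin n → Fin 2 → ℂ,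
        (∀ k k', ∑ x : Fin n → Fin 2, star (∏ l, V k l (x l)) * ∏ l, V k' l (x l) =
          if k = k' then 1 else 0) ∧
        ∀ k, (∑ x : Fin n → Fin 2, ∑ x' : Fin n → Fin 2, star (∏ l, V k l (x l)) *
          (∑ t, ∑ t', star (p b t) * G (Fin.cons t x) (Fin.cons t' x') * p b t') *
            ∏ l, V k l (x' l)).re = 0 := by
      intro b
      refine ih (fun x x' => ∑ t, ∑ t', star (p b t) * G (Fin.cons t x) (Fin.cons t' x') * p b t')
        ?_ ?_
      · refine Matrix.IsHermitian.ext fun x x' => ?_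
        simp only [star_sum, star_mul', star_star]
        rw [Finset.sum_comm]
        refine Finset.sum_congr rfl fun t _ => Finset.sum_congr rfl fun t' _ => ?_
        rw [hG.apply]
        ring
      · rw [← hp0 b, Finset.sum_comm]
        congr 1
        refine Finset.sum_congr rfl fun t _ => ?_
        rw [Finset.sum_comm]
        refine Finset.sum_congr rfl fun t' _ => ?_
        rw [Finset.mul_sum, Finset.sum_mul]
    choose V hV hV0 using step
    -- The basis is adaptive: the vectors on the later qubits depend on the outcome k 0.
    -- Orthogonality survives, since different first outcomes are already orthogonal on the first
    -- qubit.
    refine ⟨fun k => Fin.cons (p (k 0)) (V (k 0) (Fin.tail k)), ?_, ?_⟩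
    · intro k k'
      rw [sum_fin_cons]
      simp only [Fin.prod_univ_succ, Fin.cons_zero, Fin.cons_succ, star_mul']
      have : ∀ t : Fin 2, ∑ x : Fin n → Fin 2,
          star (p (k 0) t) * star (∏ l, V (k 0) (Fin.tail k) l (x l)) *
            (p (k' 0) t * ∏ l, V (k' 0) (Fin.tail k') l (x l)) =
          (star (p (k 0) t) * p (k' 0) t) * ∑ x : Fin n → Fin 2,
            star (∏ l, V (k 0) (Fin.tail k) l (x l)) *
              ∏ l, V (k' 0) (Fin.tail k') l (x l) := by
        intro t
        rw [Finset.mul_sum]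
        exact Finset.sum_congr rfl fun x _ => by ring
      rw [Finset.sum_congr rfl fun t _ => this t, ← Finset.sum_mul, hp]
      by_cases h0 : k 0 = k' 0
      · rw [h0, hV]
        have hk : k = k' ↔ Fin.tail k = Fin.tail k' := by
          refine ⟨fun h => h ▸ rfl, fun h => ?_⟩
          rw [← Fin.cons_self_tail k, ← Fin.cons_self_tail k', h0, h]
        simp [hk]
      · have hk : k ≠ k' := fun h => h0 (h ▸ rfl)
        simp [h0, hk]
    · intro k
      rw [← hV0 (k 0) (Fin.tail k), sum_fin_cons, Finset.sum_comm]
      simp_rw [sum_fin_cons]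
      simp only [Fin.prod_univ_succ, Fin.cons_zero, Fin.cons_succ, star_mul']
      congr 1
      refine Finset.sum_congr rfl fun x _ => ?_
      simp_rw [Finset.mul_sum, Finset.sum_mul]
      conv_rhs => rw [Finset.sum_comm]
      refine Finset.sum_congr rfl fun t _ => ?_
      conv_rhs => rw [Finset.sum_comm]
      refine Finset.sum_congr rfl fun t' _ => Finset.sum_congr rfl fun x' _ => ?_
      ring

lemma exists_product_orthonormalBasis_zero_diag {α : Type*} [Fintype α] [DecidableEq α]
    (G : Matrix (α → Fin 2) (α → Fin 2) ℂ) (hG : G.IsHermitian) (htr : (∑ x, G x x).re = 0) :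
    ∃ e : OrthonormalBasis (α → Fin 2) ℂ (Qubits α), (∀ k, IsProductVector (e k)) ∧
      ∀ k, (∑ x, ∑ x', star (e k x) * G x x' * e k x').re = 0 := by
  let σ : α ≃ Fin (Fintype.card α) := Fintype.equivFin α
  let τ : (Fin (Fintype.card α) → Fin 2) ≃ (α → Fin 2) := Equiv.arrowCongr σ.symm (Equiv.refl _)
  have hτ : ∀ y a, τ y a = y (σ a) := fun y a => rfl
  obtain ⟨V, hV, hV0⟩ := exists_product_family_zero_diag _ (G.submatrix τ τ) (hG.submatrix τ)
    (by
      rw [← htr, ← Equiv.sum_comp τ]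
      rfl)
  let f : (α → Fin 2) → Qubits α := fun k => WithLp.toLp 2 fun x => ∏ a, V (τ.symm k) (σ a) (x a)
  have hf : ∀ k y, f k (τ y) = ∏ l, V (τ.symm k) l (y l) := by
    intro k y
    simp only [f, hτ]
    exact Equiv.prod_comp σ (fun l => V (τ.symm k) l (y l))
  have horth : Orthonormal ℂ f := by
    rw [orthonormal_iff_ite]
    intro k k'
    rw [PiLp.inner_apply, ← Equiv.sum_comp τ]
    simp only [hf]
    have := hV (τ.symm k) (τ.symm k')
    simp only [EmbeddingLike.apply_eq_iff_eq] at this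
    rw [← this]
    refine Finset.sum_congr rfl fun x _ => ?_
    simp [mul_comm]
  have hcard : Fintype.card (α → Fin 2) = Module.finrank ℂ (Qubits α) := by simp
  let b := basisOfOrthonormalOfCardEqFinrank horth hcard
  have hb : ⇑b = f := coe_basisOfOrthonormalOfCardEqFinrank horth hcard
  refine ⟨b.toOrthonormalBasis (hb ▸ horth), ?_, ?_⟩
  · intro k
    refine ⟨fun a => WithLp.toLp 2 (V (τ.symm k) (σ a)), fun x => ?_⟩
    simp [hb, f]
  · intro k
    simp only [Module.Basis.coe_toOrthonormalBasis, hb]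
    rw [← hV0 (τ.symm k), ← Equiv.sum_comp τ]
    simp_rw [← Equiv.sum_comp τ (fun x' => star (f k (τ _)) * G _ x' * f k x'), hf]
    rfl

end ProductBasis

/-! ### Post-measurement ensembles -/

section PostMeasurement

variable {κ : Type*} [Fintype κ] [DecidableEq κ]

lemma postVector_apply_eq_inner (A : Finset κ) (f : Qubits {i // i ∈ A}) (Ψ : Qubits κ)
    (y : {i // i ∉ A} → Fin 2) :
    postVector A f Ψ y = inner ℂ f (WithLp.toLp 2 fun x => Ψ (glue A x y)) := by
  rw [PiLp.inner_apply]
  refine Finset.sum_congr rfl fun x _ => ?_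
  simp [mul_comm]

/-- Parseval's identity in the measured basis: measuring A leaves the averaged state of B unchanged.
-/
lemma sum_star_postVector_mul (A : Finset κ) (Ψ : Qubits κ)
    (e : OrthonormalBasis ({i // i ∈ A} → Fin 2) ℂ (Qubits {i // i ∈ A}))
    (y y' : {i // i ∉ A} → Fin 2) :
    ∑ k, star (postVector A (e k) Ψ y) * postVector A (e k) Ψ y' =
      ∑ x, star (Ψ (glue A x y)) * Ψ (glue A x y') := by
  have h := e.sum_inner_mul_inner (WithLp.toLp 2 fun x => Ψ (glue A x y))
    (WithLp.toLp 2 fun x => Ψ (glue A x y'))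
  rw [PiLp.inner_apply] at h
  refine (Eq.trans ?_ h).trans ?_
  · refine Finset.sum_congr rfl fun k _ => ?_
    rw [postVector_apply_eq_inner, postVector_apply_eq_inner, RCLike.star_def, inner_conj_symm]
  · refine Finset.sum_congr rfl fun x _ => ?_
    simp [mul_comm]

lemma expectation_eq_re_sum (Ψ : Qubits κ) (X : Matrix (κ → Fin 2) (κ → Fin 2) ℂ) :
    expectation Ψ X = (∑ x, ∑ y, X x y * (star (Ψ x) * Ψ y)).re := by
  rw [expectation]
  congr 1
  refine Finset.sum_congr rfl fun x _ => ?_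
  rw [Matrix.mulVec, dotProduct, Finset.mul_sum]
  exact Finset.sum_congr rfl fun y _ => by ring

lemma expectation_one (Ψ : Qubits κ) : expectation Ψ 1 = ‖Ψ‖ ^ 2 := by
  rw [expectation_eq_re_sum, EuclideanSpace.norm_sq_eq, Complex.re_sum]
  refine Finset.sum_congr rfl fun x _ => ?_
  simp only [Matrix.one_apply, ite_mul, zero_mul, one_mul, Finset.sum_ite_eq, Finset.mem_univ,
    if_true]
  rw [RCLike.star_def, mul_comm, Complex.mul_conj, Complex.normSq_eq_norm_sq,
    Complex.ofReal_re]

/-- The hypothesis `hX` encodes X = I_A ⊗ T without forming a tensor product of the two index types.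
-/
lemma expectation_extend (A : Finset κ) (Ψ : Qubits κ) {X : Matrix (κ → Fin 2) (κ → Fin 2) ℂ}
    {T : Matrix ({i // i ∉ A} → Fin 2) ({i // i ∉ A} → Fin 2) ℂ}
    (hX : ∀ x x' y y', X (glue A x y) (glue A x' y') = if x = x' then T y y' else 0) :
    expectation Ψ X =
      (∑ x, ∑ y, ∑ y', T y y' * (star (Ψ (glue A x y)) * Ψ (glue A x y'))).re := by
  rw [expectation_eq_re_sum, sum_glue A]
  congr 1
  refine Finset.sum_congr rfl fun x _ => Finset.sum_congr rfl fun y _ => ?_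
  rw [sum_glue A, Finset.sum_eq_single x]
  · exact Finset.sum_congr rfl fun y' _ => by rw [hX, if_pos rfl]
  · intro x' _ hx
    exact Finset.sum_eq_zero fun y' _ => by rw [hX, if_neg hx.symm, zero_mul]
  · simp

lemma sum_expectation_postVector (A : Finset κ) (Ψ : Qubits κ)
    (e : OrthonormalBasis ({i // i ∈ A} → Fin 2) ℂ (Qubits {i // i ∈ A}))
    {X : Matrix (κ → Fin 2) (κ → Fin 2) ℂ}
    {T : Matrix ({i // i ∉ A} → Fin 2) ({i // i ∉ A} → Fin 2) ℂ}
    (hX : ∀ x x' y y', X (glue A x y) (glue A x' y') = if x = x' then T y y' else 0) :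
    ∑ k, expectation (postVector A (e k) Ψ) T = expectation Ψ X := by
  rw [expectation_extend A Ψ hX]
  simp_rw [expectation_eq_re_sum]
  rw [← Complex.re_sum]
  refine congrArg Complex.re ?_
  calc ∑ k, ∑ y, ∑ y', T y y' * (star (postVector A (e k) Ψ y) * postVector A (e k) Ψ y')
      = ∑ y, ∑ y', T y y' * ∑ k, star (postVector A (e k) Ψ y) * postVector A (e k) Ψ y' := by
        rw [Finset.sum_comm]
        refine Finset.sum_congr rfl fun y _ => ?_
        rw [Finset.sum_comm]
        simp_rw [Finset.mul_sum]
    _ = ∑ y, ∑ x, ∑ y', T y y' * (star (Ψ (glue A x y)) * Ψ (glue A x y')) := by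
        refine Finset.sum_congr rfl fun y _ => ?_
        rw [Finset.sum_comm]
        simp_rw [sum_star_postVector_mul, Finset.mul_sum]
    _ = _ := Finset.sum_comm

lemma one_glue (A : Finset κ) (x x' : {i // i ∈ A} → Fin 2) (y y' : {i // i ∉ A} → Fin 2) :
    (1 : Matrix (κ → Fin 2) (κ → Fin 2) ℂ) (glue A x y) (glue A x' y') =
      if x = x' then (1 : Matrix ({i // i ∉ A} → Fin 2) ({i // i ∉ A} → Fin 2) ℂ) y y' else 0 := by
  have : glue A x y = glue A x' y' ↔ x = x' ∧ y = y' := by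
    refine ⟨fun h => ⟨funext fun i => ?_, funext fun i => ?_⟩, fun h => by rw [h.1, h.2]⟩
    · simpa using congrFun h i
    · simpa using congrFun h i
  simp only [Matrix.one_apply, this]
  by_cases h1 : x = x' <;> simp [h1]

lemma sum_norm_sq_postVector (A : Finset κ) (Ψ : Qubits κ)
    (e : OrthonormalBasis ({i // i ∈ A} → Fin 2) ℂ (Qubits {i // i ∈ A})) :
    ∑ k, ‖postVector A (e k) Ψ‖ ^ 2 = ‖Ψ‖ ^ 2 := by
  simp_rw [← expectation_one]
  exact sum_expectation_postVector A Ψ e (one_glue A)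

lemma norm_normalized {v : Qubits κ} (hv : v ≠ 0) : ‖((‖v‖ : ℂ)⁻¹ • v)‖ = 1 := by
  have : ‖v‖ ≠ 0 := norm_ne_zero_iff.2 hv
  rw [norm_smul, norm_inv, Complex.norm_real, norm_norm, inv_mul_cancel₀ this]

end PostMeasurement

/-! ### Attainment of the maxima and the Jensen inequality -/

section Compactness

variable {κ : Type*} [Fintype κ] [DecidableEq κ]

lemma continuous_purity (γ : Finset κ) : Continuous fun ψ : Qubits κ => purity ψ γ := by
  simp only [purity, pow_two, Matrix.trace, Matrix.diag, Matrix.mul_apply, reducedState]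
  fun_prop

lemma continuous_concentratableEntanglement (s : Finset κ) :
    Continuous (concentratableEntanglement (κ := κ) s) := by
  unfold concentratableEntanglement
  have := fun γ : Finset κ => continuous_purity γ
  fun_prop

lemma continuous_sqrtCE (s : Finset κ) : Continuous (sqrtCE (κ := κ) s) :=
  Real.continuous_sqrt.comp (continuous_concentratableEntanglement s)

/-- The contribution of an unnormalized post-measurement state is continuous, also at zero. -/
lemma continuous_norm_sq_mul_normalized {E : Qubits κ → ℝ} (hE : Continuous E) :
    Continuous fun v : Qubits κ => ‖v‖ ^ 2 * E ((‖v‖ : ℂ)⁻¹ • v) := by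
  rw [continuous_iff_continuousAt]
  intro v
  by_cases hv : v = 0
  · subst hv
    -- Normalisation is discontinuous at 0, but its values stay in the unit ball (0 is sent to 0
    -- since 0⁻¹ = 0), where E is bounded; the factor ‖w‖² then forces the limit 0.
    obtain ⟨C, hC⟩ := (isCompact_closedBall (0 : Qubits κ) 1).exists_bound_of_continuousOn
      hE.continuousOn
    have hb : ∀ w : Qubits κ, ‖‖w‖ ^ 2 * E ((‖w‖ : ℂ)⁻¹ • w)‖ ≤ ‖w‖ ^ 2 * C := by
      intro w
      rw [norm_mul, norm_pow, norm_norm]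
      refine mul_le_mul_of_nonneg_left (hC _ ?_) (by positivity)
      by_cases hw : w = 0
      · simp [hw]
      · simp [norm_normalized hw]
    rw [ContinuousAt, norm_zero]
    have hlim : Filter.Tendsto (fun w : Qubits κ => ‖w‖ ^ 2 * C) (nhds 0) (nhds 0) := by
      have : Continuous fun w : Qubits κ => ‖w‖ ^ 2 * C := by fun_prop
      simpa using this.tendsto 0
    simpa using squeeze_zero_norm hb hlim
  · have hn : (‖v‖ : ℂ) ≠ 0 := by simpa using hv
    have h1 : ContinuousAt (fun w : Qubits κ => (‖w‖ : ℂ)⁻¹ • w) v := by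
      have h2 : ContinuousAt (fun w : Qubits κ => (‖w‖ : ℂ)) v :=
        (Complex.continuous_ofReal.comp continuous_norm).continuousAt
      exact (h2.inv₀ hn).smul continuousAt_id
    exact (continuous_norm.pow 2).continuousAt.mul (hE.continuousAt.comp h1)

/-- The product vector `⨂_k v_k`. -/
def productVector (v : κ → EuclideanSpace ℂ (Fin 2)) : Qubits κ :=
  WithLp.toLp 2 fun x => ∏ k, v k (x k)

lemma continuous_productVector : Continuous (productVector (κ := κ)) := by
  unfold productVector
  fun_prop

lemma norm_productVector (v : κ → EuclideanSpace ℂ (Fin 2)) :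
    ‖productVector v‖ = ∏ k, ‖v k‖ := by
  have h : ‖productVector v‖ ^ 2 = (∏ k, ‖v k‖) ^ 2 := by
    rw [EuclideanSpace.norm_sq_eq, ← Finset.prod_pow]
    simp_rw [EuclideanSpace.norm_sq_eq]
    rw [Finset.prod_univ_sum, Fintype.piFinset_univ]
    simp [productVector, Finset.prod_pow]
  exact (sq_eq_sq₀ (norm_nonneg _) (Finset.prod_nonneg fun _ _ => norm_nonneg _)).1 h

/-- The factor norms multiply to 1, so normalising every factor does not change the product. Unit
factors are what makes the parameter space of local bases compact. -/
lemma IsProductVector.exists_unit {f : Qubits κ} (hf : IsProductVector f) (hn : ‖f‖ = 1) :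
    ∃ v : κ → EuclideanSpace ℂ (Fin 2), (∀ k, ‖v k‖ = 1) ∧ productVector v = f := by
  obtain ⟨v, hv⟩ := hf
  have hfv : f = productVector v := by
    ext x
    exact hv x
  have hprod : ∏ k, ‖v k‖ = 1 := by rw [← norm_productVector, ← hfv, hn]
  have hne : ∀ k, ‖v k‖ ≠ 0 := fun k hk => by
    rw [Finset.prod_eq_zero (Finset.mem_univ k) hk] at hprod
    exact zero_ne_one hprod
  refine ⟨fun k => (‖v k‖ : ℂ)⁻¹ • v k, fun k => ?_, ?_⟩
  · rw [norm_smul, norm_inv, Complex.norm_real, norm_norm, inv_mul_cancel₀ (hne k)]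
  · rw [hfv]
    ext x
    simp only [productVector, PiLp.smul_apply, smul_eq_mul, Finset.prod_mul_distrib,
      Finset.prod_inv_distrib]
    rw [← Complex.ofReal_prod, hprod]
    simp

lemma continuous_postVector (A : Finset κ) (Ψ : Qubits κ) :
    Continuous fun f => postVector A f Ψ := by
  unfold postVector
  fun_prop

/-- The set is a continuous image of `K`: families of unit factors, a product of spheres, cut down
by the closed condition that the product vectors be orthonormal. -/
lemma isCompact_localAverages (A : Finset κ) {E : Qubits {i // i ∉ A} → ℝ} (hE : Continuous E)
    (Ψ : Qubits κ) : IsCompact (localAverages A E Ψ) := by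
  let P := ({i // i ∈ A} → Fin 2) → {i // i ∈ A} → EuclideanSpace ℂ (Fin 2)
  let K : Set P := {V | (∀ k a, V k a ∈ Metric.sphere (0 : EuclideanSpace ℂ (Fin 2)) 1) ∧
    ∀ k k', inner ℂ (productVector (V k)) (productVector (V k')) = if k = k' then (1 : ℂ) else 0}
  have hcont : ∀ k, Continuous fun V : P => productVector (V k) := fun k =>
    continuous_productVector.comp (continuous_apply k)
  have hK : IsCompact K := by
    have h1 : IsCompact {V : P | ∀ k a, V k a ∈ Metric.sphere (0 : EuclideanSpace ℂ (Fin 2)) 1} :=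
      isCompact_pi_infinite fun k => isCompact_pi_infinite fun a => isCompact_sphere _ _
    refine h1.inter_right ?_
    have h2 : {V : P | ∀ k k', inner ℂ (productVector (V k)) (productVector (V k')) =
        if k = k' then (1 : ℂ) else 0} = ⋂ k, ⋂ k', {V : P | inner ℂ (productVector (V k))
          (productVector (V k')) = if k = k' then (1 : ℂ) else 0} := by
      ext V
      simp
    change IsClosed {V : P | ∀ k k', inner ℂ (productVector (V k)) (productVector (V k')) =
        if k = k' then (1 : ℂ) else 0}
    rw [h2]
    exact isClosed_iInter fun k => isClosed_iInter fun k' =>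
      isClosed_eq ((hcont k).inner (hcont k')) continuous_const
  let F : P → ℝ := fun V => ∑ k, ‖postVector A (productVector (V k)) Ψ‖ ^ 2 *
    E ((‖postVector A (productVector (V k)) Ψ‖ : ℂ)⁻¹ • postVector A (productVector (V k)) Ψ)
  have hF : Continuous F := by
    refine continuous_finsetSum _ fun k _ => ?_
    exact (continuous_norm_sq_mul_normalized hE).comp
      ((continuous_postVector A Ψ).comp (hcont k))
  have himage : localAverages A E Ψ = F '' K := by
    ext r
    constructor
    · rintro ⟨e, he, rfl⟩
      choose V hV hVe using fun k => (he k).exists_unit (e.orthonormal.1 k)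
      refine ⟨V, ⟨fun k a => by simpa using hV k a, fun k k' => ?_⟩, ?_⟩
      · rw [hVe, hVe]
        exact orthonormal_iff_ite.1 e.orthonormal k k'
      · simp only [F, hVe, averageEntanglement]
    · rintro ⟨V, ⟨-, hV⟩, rfl⟩
      have horth : Orthonormal ℂ fun k => productVector (V k) := orthonormal_iff_ite.2 hV
      have hcard : Fintype.card ({i // i ∈ A} → Fin 2) =
          Module.finrank ℂ (Qubits {i // i ∈ A}) := by simp
      have hb := coe_basisOfOrthonormalOfCardEqFinrank horth hcard
      refine ⟨(basisOfOrthonormalOfCardEqFinrank horth hcard).toOrthonormalBasis (by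
        rw [hb]; exact horth), ?_, ?_⟩
      · intro k
        simp only [Module.Basis.coe_toOrthonormalBasis, hb]
        exact ⟨V k, fun x => rfl⟩
      · simp only [averageEntanglement, Module.Basis.coe_toOrthonormalBasis, hb, F]
  rw [himage]
  exact hK.image hF

lemma localAverages_nonempty (A : Finset κ) (E : Qubits {i // i ∉ A} → ℝ) (Ψ : Qubits κ) :
    (localAverages A E Ψ).Nonempty := by
  obtain ⟨e, he, -⟩ := exists_product_orthonormalBasis_zero_diag
    (0 : Matrix ({i // i ∈ A} → Fin 2) ({i // i ∈ A} → Fin 2) ℂ) Matrix.isHermitian_zero (by simp)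
  exact ⟨_, e, he, rfl⟩

lemma isGreatest_localizableEntanglement (A : Finset κ) {E : Qubits {i // i ∉ A} → ℝ}
    (hE : Continuous E) (Ψ : Qubits κ) :
    IsGreatest (localAverages A E Ψ) (localizableEntanglement A E Ψ) :=
  (isCompact_localAverages A hE Ψ).isGreatest_sSup (localAverages_nonempty A E Ψ)

lemma averageEntanglement_sqrtCE_le (A : Finset κ) (s : Finset {i // i ∉ A}) (Ψ : Qubits κ)
    (hΨ : ‖Ψ‖ = 1) (e : OrthonormalBasis ({i // i ∈ A} → Fin 2) ℂ (Qubits {i // i ∈ A})) :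
    averageEntanglement A (sqrtCE s) Ψ e ≤
      √(averageEntanglement A (concentratableEntanglement s) Ψ e) := by
  refine Real.le_sqrt_of_sq_le ?_
  have hone : ∑ k, ‖postVector A (e k) Ψ‖ ^ 2 = 1 := by
    rw [sum_norm_sq_postVector, hΨ, one_pow]
  refine (Real.pow_arith_mean_le_arith_mean_pow _ _ _ (fun k _ => by positivity) hone
    (fun k _ => Real.sqrt_nonneg _) 2).trans (Finset.sum_le_sum fun k _ => ?_)
  -- An outcome of probability 0 has no normalised state, so nonnegativity of CE is not available
  -- there; its weight removes the term.
  by_cases h : postVector A (e k) Ψ = 0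
  · simp [h]
  · change _ * √_ ^ 2 ≤ _
    rw [Real.sq_sqrt (concentratableEntanglement_nonneg s _ (norm_normalized h))]

lemma localizableEntanglement_sqrtCE_le (A : Finset κ) (s : Finset {i // i ∉ A}) (Ψ : Qubits κ)
    (hΨ : ‖Ψ‖ = 1) : localizableEntanglement A (sqrtCE s) Ψ ≤
      √(localizableEntanglement A (concentratableEntanglement s) Ψ) := by
  obtain ⟨e, he, h⟩ := (isGreatest_localizableEntanglement A (continuous_sqrtCE s) Ψ).1
  rw [h]
  refine (averageEntanglement_sqrtCE_le A s Ψ hΨ e).trans (Real.sqrt_le_sqrt ?_)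
  exact (isGreatest_localizableEntanglement A (continuous_concentratableEntanglement s) Ψ).2
    ⟨e, he, rfl⟩

end Compactness

/-! ### Distinguishing two vectors by a symmetric contraction -/

section TwoVectors

variable {H : Type*} [NormedAddCommGroup H] [InnerProductSpace ℂ H]

lemma exists_phase_mul_eq_norm (z : ℂ) : ∃ ε : ℂ, ‖ε‖ = 1 ∧ ε * z = ‖z‖ := by
  by_cases hz : z = 0
  · exact ⟨1, by simp, by simp [hz]⟩
  · have hn : (‖z‖ : ℂ) ≠ 0 := by simpa using hz
    refine ⟨star z / ‖z‖, ?_, ?_⟩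
    · rw [norm_div, norm_star, Complex.norm_real, norm_norm, div_self (norm_ne_zero_iff.2 hz)]
    · rw [div_mul_eq_mul_div, RCLike.star_def, mul_comm, Complex.mul_conj,
        Complex.normSq_eq_norm_sq]
      push_cast
      field_simp

/-- A symmetric contraction cannot distinguish two vectors of equal norm better than allowed by
their overlap. -/
lemma abs_re_inner_sub_le {Y : H →ₗ[ℂ] H} (hY : Y.IsSymmetric) (hle : ∀ v, ‖Y v‖ ≤ ‖v‖)
    (u w : H) : |(inner ℂ u (Y u)).re - (inner ℂ w (Y w)).re| ≤ ‖u + w‖ * ‖u - w‖ := by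
  have h : (inner ℂ u (Y u)).re - (inner ℂ w (Y w)).re = (inner ℂ (u + w) (Y (u - w))).re := by
    have h1 : (inner ℂ u (Y w)).re = (inner ℂ w (Y u)).re := by
      rw [← hY u w, ← inner_conj_symm, Complex.conj_re]
    rw [map_sub, inner_sub_right, inner_add_left, inner_add_left]
    simp only [Complex.sub_re, Complex.add_re, h1]
    ring
  rw [h]
  refine (Complex.abs_re_le_norm _).trans ((norm_inner_le_norm _ _).trans ?_)
  exact mul_le_mul_of_nonneg_left (hle _) (norm_nonneg _)

/-- The quantity squared on the left is the covariance of Y with the ±1 observable whose two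
branches are u and w. Rescaling by ‖w‖ and ‖u‖, with a phase, gives vectors of equal norm and
nonnegative real overlap, to which `abs_re_inner_sub_le` applies. -/
lemma sq_weighted_sub_le {Y : H →ₗ[ℂ] H} (hY : Y.IsSymmetric) (hle : ∀ v, ‖Y v‖ ≤ ‖v‖)
    (u w : H) (h1 : ‖u‖ ^ 2 + ‖w‖ ^ 2 = 1) :
    (2 * (‖w‖ ^ 2 * (inner ℂ u (Y u)).re - ‖u‖ ^ 2 * (inner ℂ w (Y w)).re)) ^ 2 ≤
      4 * (‖u‖ ^ 2 * ‖w‖ ^ 2 - ‖inner ℂ u w‖ ^ 2) := by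
  obtain ⟨ε, hε, hεg⟩ := exists_phase_mul_eq_norm (inner ℂ u w)
  set n := ‖u‖
  set m := ‖w‖
  set g := ‖inner ℂ u w‖
  set u' : H := (m : ℂ) • u
  set w' : H := ((n : ℂ) * ε) • w
  have hn' : ‖u'‖ = n * m := by
    simp only [u', norm_smul, Complex.norm_real]
    rw [Real.norm_of_nonneg (norm_nonneg _), mul_comm]
  have hm' : ‖w'‖ = n * m := by
    simp only [w', norm_smul, norm_mul, Complex.norm_real, hε]
    rw [Real.norm_of_nonneg (norm_nonneg _), mul_one]
  have huY : (inner ℂ u' (Y u')).re = m ^ 2 * (inner ℂ u (Y u)).re := by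
    simp only [u', map_smul, inner_smul_left, inner_smul_right, Complex.conj_ofReal]
    rw [← mul_assoc, ← Complex.ofReal_mul, Complex.re_ofReal_mul]
    ring
  have hwY : (inner ℂ w' (Y w')).re = n ^ 2 * (inner ℂ w (Y w)).re := by
    simp only [w', map_smul, inner_smul_left, inner_smul_right]
    rw [← mul_assoc, Complex.mul_conj, Complex.normSq_eq_norm_sq,
      norm_mul, hε, Complex.norm_real, Real.norm_of_nonneg (norm_nonneg _), mul_one,
      Complex.re_ofReal_mul]
  have hre : (inner ℂ u' w').re = n * m * g := by
    have : inner ℂ u' w' = ((m * n : ℝ) : ℂ) * (ε * inner ℂ u w) := by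
      simp only [u', w', inner_smul_left, inner_smul_right, Complex.conj_ofReal]
      push_cast
      ring
    rw [this, hεg, Complex.re_ofReal_mul, Complex.ofReal_re]
    ring
  have hadd : ‖u' + w'‖ ^ 2 = 2 * (n * m) ^ 2 + 2 * (n * m * g) := by
    have := norm_add_sq (𝕜 := ℂ) u' w'
    rw [this, hn', hm']
    change _ + 2 * (inner ℂ u' w').re + _ = _
    rw [hre]
    ring
  have hsub : ‖u' - w'‖ ^ 2 = 2 * (n * m) ^ 2 - 2 * (n * m * g) := by
    have := norm_sub_sq (𝕜 := ℂ) u' w'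
    rw [this, hn', hm']
    change _ - 2 * (inner ℂ u' w').re + _ = _
    rw [hre]
    ring
  have hb := abs_re_inner_sub_le hY hle u' w'
  rw [huY, hwY] at hb
  have hsq := sq_le_sq' (by linarith [abs_nonneg (m ^ 2 * (inner ℂ u (Y u)).re -
    n ^ 2 * (inner ℂ w (Y w)).re), norm_nonneg (u' + w'), norm_nonneg (u' - w')]) hb
  rw [sq_abs, mul_pow, hadd, hsub] at hsq
  have hcs : g ≤ n * m := norm_inner_le_norm u w
  have hg : 0 ≤ g := norm_nonneg _
  -- `hsq` has right side 4 (nm)² ((nm)² - g²). The prefactor 4 (nm)² is at most 1 because n² + m² =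
  -- 1.
  have hdet : 0 ≤ n ^ 2 * m ^ 2 - g ^ 2 := by nlinarith
  have hnm : 4 * (n ^ 2 * m ^ 2) ≤ 1 := by nlinarith [sq_nonneg (n ^ 2 - m ^ 2)]
  nlinarith [mul_le_mul_of_nonneg_right hnm hdet]

end TwoVectors

/-! ### Spin observables as Hermitian involutions -/

section SpinObservables

lemma spin_apply (a : EuclideanSpace ℝ (Fin 3)) :
    spin a = !![(a 2 : ℂ), a 0 - a 1 * Complex.I; a 0 + a 1 * Complex.I, -a 2] := by
  ext t t'
  fin_cases t <;> fin_cases t' <;> simp [spin, pauli, Fin.sum_univ_three]; ring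

lemma sq_sum_eq_one {a : EuclideanSpace ℝ (Fin 3)} (ha : ‖a‖ = 1) :
    a 0 ^ 2 + a 1 ^ 2 + a 2 ^ 2 = 1 := by
  have := EuclideanSpace.norm_sq_eq a
  rw [ha] at this
  simpa [Fin.sum_univ_three] using this.symm

lemma spin_mul_self {a : EuclideanSpace ℝ (Fin 3)} (ha : ‖a‖ = 1) : spin a * spin a = 1 := by
  have h : (a 0 : ℂ) ^ 2 + (a 1 : ℂ) ^ 2 + (a 2 : ℂ) ^ 2 = 1 := by
    rw [← Complex.ofReal_one, ← sq_sum_eq_one ha]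
    push_cast
    rfl
  rw [spin_apply]
  ext t t'
  fin_cases t <;> fin_cases t' <;> simp [Matrix.mul_apply, Fin.sum_univ_two]
  · linear_combination h - (a 1 : ℂ) ^ 2 * Complex.I_sq
  · ring
  · ring
  · linear_combination h - (a 1 : ℂ) ^ 2 * Complex.I_sq

lemma spin_isHermitian (a : EuclideanSpace ℝ (Fin 3)) : (spin a).IsHermitian := by
  rw [spin_apply]
  ext t t'
  fin_cases t <;> fin_cases t' <;> simp [Matrix.conjTranspose_apply]; ring

/-- The spectral decomposition of the spin along a unit vector. -/
lemma exists_spin_eigenvectors {a : EuclideanSpace ℝ (Fin 3)} (ha : ‖a‖ = 1) :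
    ∃ p m : Fin 2 → ℂ, (∀ t t', p t * star (p t') - m t * star (m t') = spin a t t') ∧
      ∀ t t', p t * star (p t') + m t * star (m t') = (1 : Matrix (Fin 2) (Fin 2) ℂ) t t' := by
  have hsq := sq_sum_eq_one ha
  rw [spin_apply]
  -- The general eigenvector is the first column of 1 + a·σ divided by its norm √(2 (1 + a₂)); this
  -- column vanishes exactly when a₂ = -1.
  by_cases hz : a 2 = -1
  · have h0 : a 0 = 0 := by nlinarith [sq_nonneg (a 0), sq_nonneg (a 1)]
    have h1 : a 1 = 0 := by nlinarith [sq_nonneg (a 0), sq_nonneg (a 1)]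
    refine ⟨![0, 1], ![1, 0], ?_, ?_⟩ <;> intro t t' <;>
      fin_cases t <;> fin_cases t' <;> simp [hz, h0, h1]
  · have hpos : 0 < 2 * (1 + a 2) := by
      have : -1 ≤ a 2 := by nlinarith [sq_nonneg (a 0), sq_nonneg (a 1)]
      have : -1 < a 2 := lt_of_le_of_ne this (Ne.symm hz)
      linarith
    have hr : ((√(2 * (1 + a 2)) : ℝ) : ℂ) ^ 2 = 2 * (1 + a 2) := by
      rw [← Complex.ofReal_pow, Real.sq_sqrt hpos.le]
      push_cast
      ring
    have hr0 : ((√(2 * (1 + a 2)) : ℝ) : ℂ) ≠ 0 := by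
      rw [Complex.ofReal_ne_zero]
      exact (Real.sqrt_pos.2 hpos).ne'
    have h : (a 0 : ℂ) ^ 2 + (a 1 : ℂ) ^ 2 + (a 2 : ℂ) ^ 2 = 1 := by
      rw [← Complex.ofReal_one, ← hsq]
      push_cast
      rfl
    set r : ℂ := ((√(2 * (1 + a 2)) : ℝ) : ℂ) with hrdef
    have hrs : (starRingEnd ℂ) r = r := Complex.conj_ofReal _
    refine ⟨![(1 + a 2) / r, (a 0 + a 1 * Complex.I) / r],
      ![-(a 0 - a 1 * Complex.I) / r, (1 + a 2) / r], ?_, ?_⟩ <;> intro t t' <;>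
      fin_cases t <;> fin_cases t' <;> simp [hrs] <;> field_simp <;> try rw [hr]
    all_goals try ring1
    all_goals first
      | linear_combination h - (a 1 : ℂ) ^ 2 * Complex.I_sq
      | linear_combination -h + (a 1 : ℂ) ^ 2 * Complex.I_sq

variable {κ : Type*} [Fintype κ] [DecidableEq κ]

lemma tensorOp_mul (M M' : κ → Matrix (Fin 2) (Fin 2) ℂ) :
    tensorOp M * tensorOp M' = tensorOp fun k => M k * M' k := by
  ext x y
  simp only [tensorOp, Matrix.mul_apply]
  rw [Finset.prod_univ_sum, Fintype.piFinset_univ]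
  simp [Finset.prod_mul_distrib]

lemma tensorOp_isHermitian {M : κ → Matrix (Fin 2) (Fin 2) ℂ} (hM : ∀ k, (M k).IsHermitian) :
    (tensorOp M).IsHermitian := by
  ext x y
  simp only [tensorOp, Matrix.conjTranspose_apply, star_prod]
  exact Finset.prod_congr rfl fun k _ => (hM k).apply _ _

/-- A Hermitian involution is unitary: ⟨Tv, Tv⟩ = ⟨v, T²v⟩ = ⟨v, v⟩. -/
lemma norm_toEuclideanLin_of_mul_self {n : Type*} [Fintype n] [DecidableEq n] {T : Matrix n n ℂ}
    (hT : T.IsHermitian) (hsq : T * T = 1) (v : EuclideanSpace ℂ n) :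
    ‖Matrix.toEuclideanLin T v‖ = ‖v‖ := by
  have h : Matrix.toEuclideanLin T (Matrix.toEuclideanLin T v) = v := by
    simp [Matrix.toLpLin_apply, Matrix.mulVec_mulVec, hsq]
  have h2 : inner ℂ (Matrix.toEuclideanLin T v) (Matrix.toEuclideanLin T v) = inner ℂ v v := by
    rw [Matrix.isSymmetric_toEuclideanLin_iff.2 hT, h]
  rw [inner_self_eq_norm_sq_to_K, inner_self_eq_norm_sq_to_K] at h2
  exact (sq_eq_sq₀ (norm_nonneg _) (norm_nonneg _)).1 (by exact_mod_cast h2)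

end SpinObservables

/-! ### Spin correlations of a pure state against one-qubit purity -/

section PureStateBound

variable {κ : Type*} [Fintype κ] [DecidableEq κ]

/-- The component of `φ` on the other qubits when qubit `i` is in the basis state `t`. -/
def slice (φ : Qubits κ) (i : κ) (t : Fin 2) : Qubits {k // k ∉ ({i} : Finset κ)} :=
  WithLp.toLp 2 fun z => φ (glue {i} (fun _ => t) z)

lemma sum_singleton_bits {M : Type*} [AddCommMonoid M] (i : κ)
    (f : ({k // k ∈ ({i} : Finset κ)} → Fin 2) → M) : ∑ x, f x = ∑ t, f fun _ => t := by
  let _ : Unique {k // k ∈ ({i} : Finset κ)} :=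
    ⟨⟨⟨i, by simp⟩⟩, fun k => Subtype.ext (Finset.mem_singleton.1 k.2)⟩
  exact (Equiv.sum_comp (Equiv.funUnique {k // k ∈ ({i} : Finset κ)} (Fin 2)).symm f).symm

lemma reducedState_singleton (φ : Qubits κ) (i : κ) (t t' : Fin 2) :
    reducedState φ {i} (fun _ => t) (fun _ => t') = inner ℂ (slice φ i t') (slice φ i t) := by
  rw [PiLp.inner_apply]
  rfl

lemma inner_self_eq_ofReal {H : Type*} [NormedAddCommGroup H] [InnerProductSpace ℂ H] (x : H) :
    inner ℂ x x = ((‖x‖ ^ 2 : ℝ) : ℂ) := by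
  simp [inner_self_eq_norm_sq_to_K]

lemma gram_det_eq {H : Type*} [NormedAddCommGroup H] [InnerProductSpace ℂ H] (x y : H) :
    ((‖x‖ ^ 2 * ‖y‖ ^ 2 - ‖inner ℂ x y‖ ^ 2 : ℝ) : ℂ) =
      inner ℂ x x * inner ℂ y y - inner ℂ x y * inner ℂ y x := by
  rw [inner_self_eq_ofReal, inner_self_eq_ofReal, ← inner_conj_symm y x,
    Complex.mul_conj, Complex.normSq_eq_norm_sq]
  push_cast
  rfl

/-- The one-qubit marginal is the Gram matrix of the two slices, up to transposition; the trace of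
its square is the sum of the squared moduli of its entries. -/
lemma purity_singleton (φ : Qubits κ) (i : κ) :
    purity φ {i} = ‖slice φ i 0‖ ^ 4 + ‖slice φ i 1‖ ^ 4 +
      2 * ‖inner ℂ (slice φ i 0) (slice φ i 1)‖ ^ 2 := by
  rw [purity, pow_two, Matrix.trace, sum_singleton_bits]
  simp only [Matrix.diag, Matrix.mul_apply]
  simp_rw [sum_singleton_bits i (fun x => reducedState φ {i} _ x * reducedState φ {i} x _),
    reducedState_singleton, Fin.sum_univ_two]
  have h01 : inner ℂ (slice φ i 1) (slice φ i 0) * inner ℂ (slice φ i 0) (slice φ i 1) =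
      ((‖inner ℂ (slice φ i 0) (slice φ i 1)‖ ^ 2 : ℝ) : ℂ) := by
    rw [← inner_conj_symm, mul_comm, Complex.mul_conj, Complex.normSq_eq_norm_sq]
  rw [mul_comm (inner ℂ (slice φ i 0) (slice φ i 1)), h01, inner_self_eq_ofReal,
    inner_self_eq_ofReal, ← Complex.ofReal_re (_ + 2 * _)]
  congr 1
  push_cast
  ring

lemma norm_sq_eq_slices (φ : Qubits κ) (i : κ) :
    ‖φ‖ ^ 2 = ‖slice φ i 0‖ ^ 2 + ‖slice φ i 1‖ ^ 2 := by
  simp_rw [EuclideanSpace.norm_sq_eq]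
  rw [sum_glue {i}, sum_singleton_bits, Fin.sum_univ_two]
  rfl

lemma expectation_tensorOp_slice (φ : Qubits κ) (i : κ) (M : κ → Matrix (Fin 2) (Fin 2) ℂ) :
    expectation φ (tensorOp M) = (∑ t, ∑ t', M i t t' * inner ℂ (slice φ i t)
      (Matrix.toEuclideanLin (tensorOp fun k : {k // k ∉ ({i} : Finset κ)} => M k)
        (slice φ i t'))).re := by
  have h1 : ∀ t t', tensorOp (fun k : {k // k ∈ ({i} : Finset κ)} => M k) (fun _ => t)
      (fun _ => t') = M i t t' := by
    intro t t'
    unfold tensorOp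
    exact Finset.prod_attach {i} (fun k => M k t t') |>.trans (by simp)
  rw [expectation_eq_re_sum, sum_glue {i}, sum_singleton_bits]
  congr 1
  refine Finset.sum_congr rfl fun t _ => ?_
  calc _ = ∑ z, ∑ t', ∑ z', tensorOp M (glue {i} (fun _ => t) z) (glue {i} (fun _ => t') z') *
        (star (φ (glue {i} (fun _ => t) z)) * φ (glue {i} (fun _ => t') z')) := by
        refine Finset.sum_congr rfl fun z _ => ?_
        rw [sum_glue {i}, sum_singleton_bits]
    _ = _ := by
        rw [Finset.sum_comm]
        refine Finset.sum_congr rfl fun t' _ => ?_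
        rw [PiLp.inner_apply, Finset.mul_sum]
        refine Finset.sum_congr rfl fun z _ => ?_
        simp only [tensorOp_glue, h1, slice, Matrix.toLpLin_apply, Matrix.mulVec, dotProduct,
          RCLike.inner_apply, Finset.sum_mul, Finset.mul_sum]
        refine Finset.sum_congr rfl fun z' _ => ?_
        rw [RCLike.star_def]
        ring

/-- Twice the square root of the determinant of a one-qubit marginal (the concurrence) bounds all
connected spin correlations of that qubit in a pure state. -/
lemma spinCorrelation_sq_le (φ : Qubits κ) (hφ : ‖φ‖ = 1) {i j : κ} (hij : i ≠ j)
    {a b : EuclideanSpace ℝ (Fin 3)} (ha : ‖a‖ = 1) (hb : ‖b‖ = 1) :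
    spinCorrelation φ i j a b ^ 2 ≤ 2 * (1 - purity φ {i}) := by
  obtain ⟨p, m, hsub, hadd⟩ := exists_spin_eigenvectors ha
  set S := slice φ i
  set T := tensorOp (fun k : {k // k ∉ ({i} : Finset κ)} =>
    Function.update (fun _ => (1 : Matrix (Fin 2) (Fin 2) ℂ)) j (spin b) k) with hT
  set Y := Matrix.toEuclideanLin T with hYdef
  have hTh : T.IsHermitian := tensorOp_isHermitian fun k => by
    by_cases hk : (k : κ) = j
    · rw [hk, Function.update_self]
      exact spin_isHermitian b
    · rw [Function.update_of_ne hk]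
      exact Matrix.isHermitian_one
  have hTsq : T * T = 1 := by
    rw [hT, tensorOp_mul, ← tensorOp_one]
    congr 1
    funext k
    by_cases hk : (k : κ) = j
    · rw [hk, Function.update_self]
      exact spin_mul_self hb
    · rw [Function.update_of_ne hk, one_mul]
  have hY : Y.IsSymmetric := Matrix.isSymmetric_toEuclideanLin_iff.2 hTh
  have hle : ∀ v, ‖Y v‖ ≤ ‖v‖ := fun v => (norm_toEuclideanLin_of_mul_self hTh hTsq v).le
  -- u and w are the components ⟨p|φ⟩ and ⟨m|φ⟩ of φ along the two spin eigenvectors of qubit i,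
  -- that is, the slices in the eigenbasis.
  set u := star (p 0) • S 0 + star (p 1) • S 1
  set w := star (m 0) • S 0 + star (m 1) • S 1
  have form : ∀ (q : Fin 2 → ℂ) (Z : Qubits {k // k ∉ ({i} : Finset κ)} →ₗ[ℂ]
      Qubits {k // k ∉ ({i} : Finset κ)}),
      inner ℂ (star (q 0) • S 0 + star (q 1) • S 1) (Z (star (q 0) • S 0 + star (q 1) • S 1)) =
        ∑ t, ∑ t', (q t * star (q t')) * inner ℂ (S t) (Z (S t')) := by
    intro q Z
    simp only [map_add, map_smul, inner_add_left, inner_add_right, inner_smul_left,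
      inner_smul_right, Fin.sum_univ_two, RCLike.star_def, Complex.conj_conj]
    ring
  have spinForm : ∀ Z : Qubits {k // k ∉ ({i} : Finset κ)} →ₗ[ℂ]
      Qubits {k // k ∉ ({i} : Finset κ)},
      ∑ t, ∑ t', spin a t t' * inner ℂ (S t) (Z (S t')) = inner ℂ u (Z u) - inner ℂ w (Z w) := by
    intro Z
    rw [form p, form m]
    simp_rw [← hsub, sub_mul, Finset.sum_sub_distrib]
  have oneForm : ∀ Z : Qubits {k // k ∉ ({i} : Finset κ)} →ₗ[ℂ]
      Qubits {k // k ∉ ({i} : Finset κ)},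
      ∑ t, ∑ t', (1 : Matrix (Fin 2) (Fin 2) ℂ) t t' * inner ℂ (S t) (Z (S t')) =
        inner ℂ u (Z u) + inner ℂ w (Z w) := by
    intro Z
    rw [form p, form m]
    simp_rw [← hadd, add_mul, Finset.sum_add_distrib]
  have hnorm : ‖u‖ ^ 2 + ‖w‖ ^ 2 = 1 := by
    have h := congrArg Complex.re (oneForm LinearMap.id)
    have hS := norm_sq_eq_slices φ i
    simp only [LinearMap.id_apply, Matrix.one_apply, ite_mul, one_mul, zero_mul,
      Finset.sum_ite_eq, Finset.mem_univ, if_true, Fin.sum_univ_two, Complex.add_re,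
      inner_self_eq_ofReal, Complex.ofReal_re] at h
    rw [← h, ← hS, hφ, one_pow]
  -- The Gram determinant is multiplied by |det|² of the change of basis; this factor is 1 (`hV`)
  -- because p, m resolve the identity.
  have hdet : ‖u‖ ^ 2 * ‖w‖ ^ 2 - ‖inner ℂ u w‖ ^ 2 =
      ‖S 0‖ ^ 2 * ‖S 1‖ ^ 2 - ‖inner ℂ (S 0) (S 1)‖ ^ 2 := by
    rw [← Complex.ofReal_inj, gram_det_eq, gram_det_eq]
    have h00 := hadd 0 0
    have h01 := hadd 0 1
    have h10 := hadd 1 0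
    have h11 := hadd 1 1
    simp only [RCLike.star_def, Matrix.one_apply, Fin.isValue, if_true, zero_ne_one, one_ne_zero,
      if_false] at h00 h01 h10 h11
    have hV : (p 0 * m 1 - p 1 * m 0) * ((starRingEnd ℂ) (p 0) * (starRingEnd ℂ) (m 1) -
        (starRingEnd ℂ) (p 1) * (starRingEnd ℂ) (m 0)) = 1 := by
      linear_combination (p 1 * (starRingEnd ℂ) (p 1) + m 1 * (starRingEnd ℂ) (m 1)) * h00 + h11 -
        (p 1 * (starRingEnd ℂ) (p 0) + m 1 * (starRingEnd ℂ) (m 0)) * h01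
    simp only [u, w, inner_add_left, inner_add_right, inner_smul_left, inner_smul_right,
      RCLike.star_def, Complex.conj_conj]
    linear_combination (inner ℂ (S 0) (S 0) * inner ℂ (S 1) (S 1) -
      inner ℂ (S 0) (S 1) * inner ℂ (S 1) (S 0)) * hV
  have hXY : expectation φ (tensorOp (Function.update (Function.update (fun _ => 1) i (spin a))
      j (spin b))) = (inner ℂ u (Y u)).re - (inner ℂ w (Y w)).re := by
    have hrest : (tensorOp fun k : {k // k ∉ ({i} : Finset κ)} => Function.update
        (Function.update (fun _ => (1 : Matrix (Fin 2) (Fin 2) ℂ)) i (spin a)) j (spin b) k) =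
          T := by
      rw [hT]
      congr 1
      funext k
      have hk : (k : κ) ≠ i := by simpa using k.2
      by_cases hkj : (k : κ) = j
      · rw [hkj, Function.update_self, Function.update_self]
      · rw [Function.update_of_ne hkj, Function.update_of_ne hk, Function.update_of_ne hkj]
    rw [expectation_tensorOp_slice φ i, hrest, Function.update_of_ne hij, Function.update_self,
      ← Complex.sub_re, spinForm]
  have hX : expectation φ (tensorOp (Function.update (fun _ => 1) i (spin a))) =
      ‖u‖ ^ 2 - ‖w‖ ^ 2 := by
    have hone : (tensorOp fun k : {k // k ∉ ({i} : Finset κ)} =>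
        Function.update (fun _ => (1 : Matrix (Fin 2) (Fin 2) ℂ)) i (spin a) k) = 1 := by
      rw [← tensorOp_one]
      congr 1
      funext k
      have hk : (k : κ) ≠ i := by simpa using k.2
      rw [Function.update_of_ne hk]
    rw [expectation_tensorOp_slice φ i, hone, Function.update_self, spinForm]
    simp only [Matrix.toLpLin_one, LinearMap.id_apply, inner_self_eq_ofReal, Complex.sub_re,
      Complex.ofReal_re]
  have hYe : expectation φ (tensorOp (Function.update (fun _ => 1) j (spin b))) =
      (inner ℂ u (Y u)).re + (inner ℂ w (Y w)).re := by
    rw [expectation_tensorOp_slice φ i, Function.update_of_ne hij, oneForm, Complex.add_re]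
  have hfinal := sq_weighted_sub_le hY hle u w hnorm
  rw [spinCorrelation, hXY, hX, hYe, purity_singleton]
  have hS := norm_sq_eq_slices φ i
  rw [hφ] at hS
  rw [hdet] at hfinal
  -- For a marginal of trace 1, 1 - purity is twice its determinant.
  have e1 : 2 * (1 - (‖S 0‖ ^ 4 + ‖S 1‖ ^ 4 + 2 * ‖inner ℂ (S 0) (S 1)‖ ^ 2)) =
      4 * (‖S 0‖ ^ 2 * ‖S 1‖ ^ 2 - ‖inner ℂ (S 0) (S 1)‖ ^ 2) := by
    linear_combination 2 * (1 + ‖S 0‖ ^ 2 + ‖S 1‖ ^ 2) * hS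
  rw [e1]
  refine le_of_eq_of_le ?_ hfinal
  congr 1
  have e2 : ‖u‖ ^ 2 = 1 - ‖w‖ ^ 2 := by linarith
  rw [e2]
  ring

lemma abs_spinCorrelation_le_sqrtCE (s : Finset κ) (φ : Qubits κ) (hφ : ‖φ‖ = 1) {i j : κ}
    (hi : i ∈ s) (hij : i ≠ j) {a b : EuclideanSpace ℝ (Fin 3)} (ha : ‖a‖ = 1) (hb : ‖b‖ = 1) :
    1 / 2 * |spinCorrelation φ i j a b| ≤ sqrtCE s φ := by
  refine Real.le_sqrt_of_sq_le ?_
  have h1 := spinCorrelation_sq_le φ hφ hij ha hb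
  have h2 := one_sub_purity_singleton_le s φ hφ hi
  rw [mul_pow, sq_abs]
  linarith

end PureStateBound

/-! ### A covariance-preserving local measurement -/

section LowerBound

variable {κ : Type*} [Fintype κ] [DecidableEq κ]

lemma tensorOp_glue_of_eq_one (A : Finset κ) {M : κ → Matrix (Fin 2) (Fin 2) ℂ}
    (hM : ∀ k ∈ A, M k = 1) (x x' : {i // i ∈ A} → Fin 2) (y y' : {i // i ∉ A} → Fin 2) :
    tensorOp M (glue A x y) (glue A x' y') =
      if x = x' then tensorOp (fun k : {i // i ∉ A} => M k) y y' else 0 := by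
  have h : (fun k : {i // i ∈ A} => M k) = fun _ => 1 := funext fun k => hM k k.2
  rw [tensorOp_glue, h, tensorOp_one, Matrix.one_apply]
  simp

lemma restrict_update {β : Type*} (A : Finset κ) (f : κ → β) (i : {i // i ∉ A}) (v : β) :
    (fun k : {i // i ∉ A} => Function.update f i v k) =
      Function.update (fun k : {i // i ∉ A} => f k) i v :=
  Function.update_comp_eq_of_injective f Subtype.val_injective i v

lemma expectation_sub_smul_one (Ψ : Qubits κ) (X : Matrix (κ → Fin 2) (κ → Fin 2) ℂ) (c : ℝ) :
    expectation Ψ (X - (c : ℂ) • 1) = expectation Ψ X - c * ‖Ψ‖ ^ 2 := by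
  rw [← expectation_one]
  simp only [expectation_eq_re_sum, Matrix.sub_apply, Matrix.smul_apply, sub_mul,
    Finset.sum_sub_distrib, Complex.sub_re, smul_eq_mul, mul_assoc, ← Finset.mul_sum,
    Complex.re_ofReal_mul]

lemma expectation_smul (c : ℂ) (Ψ : Qubits κ) (X : Matrix (κ → Fin 2) (κ → Fin 2) ℂ) :
    expectation (c • Ψ) X = ‖c‖ ^ 2 * expectation Ψ X := by
  rw [expectation_eq_re_sum, expectation_eq_re_sum, ← Complex.re_ofReal_mul]
  congr 1
  simp_rw [Finset.mul_sum]
  refine Finset.sum_congr rfl fun x _ => Finset.sum_congr rfl fun y _ => ?_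
  rw [← Complex.normSq_eq_norm_sq, ← Complex.mul_conj]
  simp only [PiLp.smul_apply, smul_eq_mul, star_mul', RCLike.star_def]
  ring

/-- There is a local measurement on `A` all of whose outcomes leave the mean value of a given
observable on the complement unchanged. -/
lemma exists_local_measurement_mean_preserving (A : Finset κ) (Ψ : Qubits κ) (hΨ : ‖Ψ‖ = 1)
    {X : Matrix (κ → Fin 2) (κ → Fin 2) ℂ}
    {T : Matrix ({i // i ∉ A} → Fin 2) ({i // i ∉ A} → Fin 2) ℂ} (hT : T.IsHermitian)
    (hX : ∀ x x' y y', X (glue A x y) (glue A x' y') = if x = x' then T y y' else 0) :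
    ∃ e : OrthonormalBasis ({i // i ∈ A} → Fin 2) ℂ (Qubits {i // i ∈ A}),
      (∀ k, IsProductVector (e k)) ∧
      ∀ k, expectation (postVector A (e k) Ψ) T =
        expectation Ψ X * ‖postVector A (e k) Ψ‖ ^ 2 := by
  set c := expectation Ψ X
  have hK : (T - (c : ℂ) • 1).IsHermitian := by
    refine hT.sub ?_
    rw [Matrix.IsHermitian, Matrix.conjTranspose_smul, Matrix.conjTranspose_one]
    simp
  have hKX : ∀ x x' y y', (X - (c : ℂ) • 1) (glue A x y) (glue A x' y') =
      if x = x' then (T - (c : ℂ) • 1) y y' else 0 := by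
    intro x x' y y'
    simp only [Matrix.sub_apply, Matrix.smul_apply, hX, one_glue]
    split_ifs <;> simp
  -- This matrix on A has as its diagonal entry at e_k the expectation of T - c in the k-th
  -- post-measurement vector. Its trace is ⟨X⟩ - c = 0.
  obtain ⟨e, he, hzero⟩ := exists_product_orthonormalBasis_zero_diag
    (Matrix.of fun x' x => ∑ y, ∑ y', (T - (c : ℂ) • 1) y y' *
      (star (Ψ (glue A x y)) * Ψ (glue A x' y')))
    (by
      refine Matrix.IsHermitian.ext fun x x' => ?_
      simp only [Matrix.of_apply, star_sum, star_mul', star_star]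
      rw [Finset.sum_comm]
      refine Finset.sum_congr rfl fun y _ => Finset.sum_congr rfl fun y' _ => ?_
      rw [hK.apply]
      ring)
    (by
      simp only [Matrix.of_apply]
      rw [← expectation_extend A Ψ hKX, expectation_sub_smul_one, hΨ]
      simp [c])
  refine ⟨e, he, fun k => ?_⟩
  have hk : expectation (postVector A (e k) Ψ) (T - (c : ℂ) • 1) = 0 := by
    rw [← hzero k, expectation_eq_re_sum]
    congr 1
    simp only [Matrix.of_apply, postVector, star_sum, star_mul', star_star]
    calc _ = ∑ y, ∑ y', ∑ x', ∑ x, star (e k x') * ((T - (c : ℂ) • 1) y y' *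
            (star (Ψ (glue A x y)) * Ψ (glue A x' y'))) * e k x := by
          refine Finset.sum_congr rfl fun y _ => Finset.sum_congr rfl fun y' _ => ?_
          rw [Finset.sum_mul_sum, Finset.sum_comm, Finset.mul_sum]
          refine Finset.sum_congr rfl fun x' _ => ?_
          rw [Finset.mul_sum]
          exact Finset.sum_congr rfl fun x _ => by ring
      _ = ∑ x', ∑ x, ∑ y, ∑ y', star (e k x') * ((T - (c : ℂ) • 1) y y' *
            (star (Ψ (glue A x y)) * Ψ (glue A x' y'))) * e k x := by
          simp_rw [Finset.sum_comm (s := (Finset.univ : Finset ({i // i ∉ A} → Fin 2)))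
            (t := (Finset.univ : Finset ({i // i ∈ A} → Fin 2)))]
      _ = _ := by
          simp_rw [Finset.mul_sum, Finset.sum_mul]
  rw [expectation_sub_smul_one] at hk
  linarith

lemma update_spin_isHermitian (i : κ) (a : EuclideanSpace ℝ (Fin 3)) (k : κ) :
    (Function.update (fun _ => (1 : Matrix (Fin 2) (Fin 2) ℂ)) i (spin a) k).IsHermitian := by
  by_cases hk : k = i
  · rw [hk, Function.update_self]
    exact spin_isHermitian a
  · rw [Function.update_of_ne hk]
    exact Matrix.isHermitian_one

/-- Measure so that the mean of the spin at i is the same for every outcome. The product term of the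
covariance is then linear in the ensemble, so the weighted covariances of the outcomes add up to
that of Ψ, and each is bounded by the pure-state estimate. -/
lemma half_abs_spinCorrelation_le (A : Finset κ) (s : Finset {i // i ∉ A}) (Ψ : Qubits κ)
    (hΨ : ‖Ψ‖ = 1) {i j : {i // i ∉ A}} (hi : i ∈ s) (hij : i ≠ j)
    {a b : EuclideanSpace ℝ (Fin 3)} (ha : ‖a‖ = 1) (hb : ‖b‖ = 1) :
    1 / 2 * |spinCorrelation Ψ i j a b| ≤ localizableEntanglement A (sqrtCE s) Ψ := by
  have hne : ∀ (l : {i // i ∉ A}), ∀ k ∈ A, k ≠ l := fun l k hk h => l.2 (h ▸ hk)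
  have hX := tensorOp_glue_of_eq_one A
    (M := Function.update (fun _ => 1) (i : κ) (spin a))
    (fun k hk => Function.update_of_ne (hne i k hk) _ _)
  have hY := tensorOp_glue_of_eq_one A
    (M := Function.update (fun _ => 1) (j : κ) (spin b))
    (fun k hk => Function.update_of_ne (hne j k hk) _ _)
  have hZ := tensorOp_glue_of_eq_one A
    (M := Function.update (Function.update (fun _ => 1) (i : κ) (spin a)) (j : κ) (spin b))
    (fun k hk => by rw [Function.update_of_ne (hne j k hk), Function.update_of_ne (hne i k hk)])
  simp only [restrict_update] at hX hY hZ
  obtain ⟨e, he, hmean⟩ := exists_local_measurement_mean_preserving A Ψ hΨ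
    (tensorOp_isHermitian (update_spin_isHermitian i a)) hX
  refine le_trans ?_ ((isGreatest_localizableEntanglement A (continuous_sqrtCE s) Ψ).2
    ⟨e, he, rfl⟩)
  rw [spinCorrelation, averageEntanglement, ← sum_expectation_postVector A Ψ e hZ,
    ← sum_expectation_postVector A Ψ e hY, Finset.mul_sum, ← Finset.sum_sub_distrib]
  refine (mul_le_mul_of_nonneg_left (Finset.abs_sum_le_sum_abs _ _) (by norm_num)).trans ?_
  rw [Finset.mul_sum]
  refine Finset.sum_le_sum fun k _ => ?_
  have hk := hmean k
  set v := postVector A (e k) Ψ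
  by_cases hv : v = 0
  · simp [hv, expectation]
  · have hpos : 0 < ‖v‖ ^ 2 := by positivity
    have hcorr : ‖v‖ ^ 2 * spinCorrelation ((‖v‖ : ℂ)⁻¹ • v) i j a b =
        expectation v (tensorOp (Function.update (Function.update (fun _ => 1) i (spin a))
          j (spin b))) -
        expectation Ψ (tensorOp (Function.update (fun _ => 1) (i : κ) (spin a))) *
          expectation v (tensorOp (Function.update (fun _ => 1) j (spin b))) := by
      rw [spinCorrelation]
      simp only [expectation_smul]
      rw [hk, norm_inv, Complex.norm_real, norm_norm]
      field_simp
    rw [← hcorr, abs_mul, abs_of_pos hpos, mul_left_comm]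
    exact mul_le_mul_of_nonneg_left
      (abs_spinCorrelation_le_sqrtCE s _ (norm_normalized hv) hi hij ha hb) hpos.le

end LowerBound

/-! ### The largest singular value as a maximum over directions -/

section SingularValues

/-- In an eigenbasis of T*T, ‖Tv‖² is the sum of σ_i² times the squared coordinates of v, and σ_i ≤
σ_0. -/
lemma norm_apply_le_singularValue_zero {E F : Type*} [NormedAddCommGroup E]
    [InnerProductSpace ℝ E] [FiniteDimensional ℝ E] [NormedAddCommGroup F]
    [InnerProductSpace ℝ F] [FiniteDimensional ℝ F] (T : E →ₗ[ℝ] F) (v : E) :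
    ‖T v‖ ≤ T.singularValues 0 * ‖v‖ := by
  set hS := T.isSymmetric_adjoint_comp_self
  set B := hS.eigenvectorBasis rfl
  refine le_of_sq_le_sq ?_ (mul_nonneg (T.singularValues_nonneg 0) (norm_nonneg v))
  have h1 : ‖T v‖ ^ 2 = inner ℝ v ((LinearMap.adjoint T ∘ₗ T) v) := by
    rw [LinearMap.comp_apply, LinearMap.adjoint_inner_right, real_inner_self_eq_norm_sq]
  rw [h1, ← B.sum_inner_mul_inner, mul_pow, ← B.sum_sq_norm_inner_right v, Finset.mul_sum]
  refine Finset.sum_le_sum fun i _ => ?_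
  have h2 : inner ℝ (B i) ((LinearMap.adjoint T ∘ₗ T) v) =
      T.singularValues i ^ 2 * inner ℝ (B i) v := by
    rw [T.sq_singularValues_fin rfl i, ← hS (B i) v, hS.apply_eigenvectorBasis]
    simp [inner_smul_left, B]
  rw [h2, real_inner_comm v, Real.norm_eq_abs, sq_abs]
  have h3 : T.singularValues i ^ 2 ≤ T.singularValues 0 ^ 2 :=
    pow_le_pow_left₀ (T.singularValues_nonneg _) (T.singularValues_antitone (Nat.zero_le _)) 2
  nlinarith [sq_nonneg (inner ℝ (B i) v)]

lemma exists_norm_apply_eq_singularValue_zero {E F : Type*} [NormedAddCommGroup E]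
    [InnerProductSpace ℝ E] [FiniteDimensional ℝ E] [Nontrivial E] [NormedAddCommGroup F]
    [InnerProductSpace ℝ F] [FiniteDimensional ℝ F] (T : E →ₗ[ℝ] F) :
    ∃ v : E, ‖v‖ = 1 ∧ ‖T v‖ = T.singularValues 0 := by
  set hS := T.isSymmetric_adjoint_comp_self
  set v := hS.eigenvectorBasis rfl ⟨0, Module.finrank_pos⟩ with hvdef
  have hv : ‖v‖ = 1 := (hS.eigenvectorBasis rfl).orthonormal.1 _
  refine ⟨v, hv, (sq_eq_sq₀ (norm_nonneg _) (T.singularValues_nonneg 0)).1 ?_⟩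
  have h1 : ‖T v‖ ^ 2 = inner ℝ v ((LinearMap.adjoint T ∘ₗ T) v) := by
    rw [LinearMap.comp_apply, LinearMap.adjoint_inner_right, real_inner_self_eq_norm_sq]
  rw [h1, hvdef, hS.apply_eigenvectorBasis, ← hvdef, inner_smul_right,
    real_inner_self_eq_norm_sq, hv, T.sq_singularValues_of_lt rfl Module.finrank_pos]
  simp

/-- Cauchy–Schwarz bounds the values; equality occurs for b a top right singular vector and a in the
direction of T b (any unit vector if T b = 0). -/
lemma isGreatest_abs_inner_apply {E F : Type*} [NormedAddCommGroup E]
    [InnerProductSpace ℝ E] [FiniteDimensional ℝ E] [Nontrivial E] [NormedAddCommGroup F]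
    [InnerProductSpace ℝ F] [FiniteDimensional ℝ F] [Nontrivial F] (T : E →ₗ[ℝ] F) :
    IsGreatest {r | ∃ (a : F) (b : E), ‖a‖ = 1 ∧ ‖b‖ = 1 ∧ r = |inner ℝ a (T b)|}
      (T.singularValues 0) := by
  constructor
  · obtain ⟨b, hb, hTb⟩ := exists_norm_apply_eq_singularValue_zero T
    by_cases h0 : T b = 0
    · obtain ⟨a, ha⟩ := exists_norm_eq F zero_le_one
      exact ⟨a, b, ha, hb, by rw [← hTb, h0]; simp⟩
    · have hn : ‖T b‖ ≠ 0 := norm_ne_zero_iff.2 h0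
      refine ⟨‖T b‖⁻¹ • T b, b, ?_, hb, ?_⟩
      · rw [norm_smul, norm_inv, norm_norm, inv_mul_cancel₀ hn]
      · rw [inner_smul_left, real_inner_self_eq_norm_sq, ← hTb]
        simp only [conj_trivial, pow_two]
        rw [← mul_assoc, inv_mul_cancel₀ hn, one_mul, abs_norm]
  · rintro r ⟨a, b, ha, hb, rfl⟩
    refine (abs_real_inner_le_norm _ _).trans ?_
    have := norm_apply_le_singularValue_zero T b
    rw [ha, one_mul]
    rwa [hb, mul_one] at this

variable {κ : Type*} [Fintype κ] [DecidableEq κ]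

/-- The tensor product is linear in its i-th factor, and a·σ is linear in a. Using this at i and at
j makes Q bilinear. -/
lemma expectation_tensorOp_update_spin (Ψ : Qubits κ) (f : κ → Matrix (Fin 2) (Fin 2) ℂ) (i : κ)
    (a : EuclideanSpace ℝ (Fin 3)) :
    expectation Ψ (tensorOp (Function.update f i (spin a))) =
      ∑ p, a p * expectation Ψ (tensorOp
        (Function.update f i (spin (EuclideanSpace.single p 1)))) := by
  have hprod : ∀ (N : Matrix (Fin 2) (Fin 2) ℂ) (x y : κ → Fin 2),
      tensorOp (Function.update f i N) x y =
        N (x i) (y i) * ∏ k ∈ Finset.univ.erase i, f k (x k) (y k) := by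
    intro N x y
    unfold tensorOp
    rw [← Finset.mul_prod_erase _ _ (Finset.mem_univ i), Function.update_self]
    congr 1
    exact Finset.prod_congr rfl fun k hk => by
      rw [Function.update_of_ne (Finset.ne_of_mem_erase hk)]
  have hspin : ∀ t t', spin a t t' =
      ∑ p, (a p : ℂ) * spin (EuclideanSpace.single p 1) t t' := by
    intro t t'
    simp only [spin_apply]
    fin_cases t <;> fin_cases t' <;> simp [Fin.sum_univ_three]; ring
  simp_rw [expectation_eq_re_sum, ← Complex.re_ofReal_mul]
  rw [← Complex.re_sum]
  congr 1
  simp_rw [hprod, hspin, Finset.sum_mul, Finset.mul_sum]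
  symm
  rw [Finset.sum_comm]
  refine Finset.sum_congr rfl fun x _ => ?_
  rw [Finset.sum_comm]
  refine Finset.sum_congr rfl fun y _ => Finset.sum_congr rfl fun p _ => ?_
  ring

lemma spinCorrelation_eq_inner (Ψ : Qubits κ) {i j : κ} (hij : i ≠ j)
    (a b : EuclideanSpace ℝ (Fin 3)) :
    spinCorrelation Ψ i j a b =
      inner ℝ a (Matrix.toEuclideanLin (correlationMatrix Ψ i j) b) := by
  have hb : ∀ a, spinCorrelation Ψ i j a b =
      ∑ q, b q * spinCorrelation Ψ i j a (EuclideanSpace.single q 1) := by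
    intro a
    simp only [spinCorrelation]
    rw [expectation_tensorOp_update_spin _ _ j, expectation_tensorOp_update_spin _ _ j b,
      Finset.mul_sum, ← Finset.sum_sub_distrib]
    exact Finset.sum_congr rfl fun q _ => by ring
  have ha : ∀ b, spinCorrelation Ψ i j a b =
      ∑ p, a p * spinCorrelation Ψ i j (EuclideanSpace.single p 1) b := by
    intro b
    simp only [spinCorrelation, Function.update_comm hij]
    rw [expectation_tensorOp_update_spin _ _ i, expectation_tensorOp_update_spin _ _ i a,
      Finset.sum_mul, ← Finset.sum_sub_distrib]
    exact Finset.sum_congr rfl fun q _ => by ring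
  rw [ha, PiLp.inner_apply]
  refine Finset.sum_congr rfl fun p _ => ?_
  rw [hb]
  simp only [Matrix.toLpLin_apply, Matrix.mulVec, dotProduct, correlationMatrix,
    RCLike.inner_apply, conj_trivial]
  rw [mul_comm]
  congr 1
  exact Finset.sum_congr rfl fun q _ => mul_comm _ _

lemma isGreatest_pairCorrelations (Ψ : Qubits κ) {i j : κ} (hij : i ≠ j) :
    IsGreatest (pairCorrelations Ψ i j) (maxSingularValue (correlationMatrix Ψ i j)) := by
  have h := isGreatest_abs_inner_apply (Matrix.toEuclideanLin (correlationMatrix Ψ i j))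
  simp_rw [← spinCorrelation_eq_inner Ψ hij] at h
  exact h

/-- The maximal correlation over a finite set with two distinct points is attained by a pair. -/
lemma exists_isGreatest_allCorrelations (Ψ : Qubits κ) {S : Set κ} (hS : S.Nontrivial) :
    ∃ i ∈ S, ∃ j ∈ S, i ≠ j ∧
      IsGreatest (allCorrelations Ψ S) (maxSingularValue (correlationMatrix Ψ i j)) := by
  obtain ⟨i₀, hi₀, j₀, hj₀, hne⟩ := hS
  let D : Set (κ × κ) := {q | q.1 ∈ S ∧ q.2 ∈ S ∧ q.1 ≠ q.2}
  obtain ⟨⟨i, j⟩, ⟨hi, hj, hij⟩, hmax⟩ := D.toFinite.exists_maximalFor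
    (fun q => maxSingularValue (correlationMatrix Ψ q.1 q.2)) D ⟨(i₀, j₀), hi₀, hj₀, hne⟩
  refine ⟨i, hi, j, hj, hij, ⟨i, hi, j, hj, hij, (isGreatest_pairCorrelations Ψ hij).1⟩, ?_⟩
  rintro r ⟨i', hi', j', hj', hij', hr⟩
  refine ((isGreatest_pairCorrelations Ψ hij').2 hr).trans ?_
  rcases le_total (maxSingularValue (correlationMatrix Ψ i' j'))
    (maxSingularValue (correlationMatrix Ψ i j)) with h | h
  · exact h
  · exact hmax (j := (i', j')) ⟨hi', hj', hij'⟩ h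

end SingularValues

end

theorem mainTheorem7 (N : ℕ) (A : Finset (Fin N)) (s : Finset {i : Fin N // i ∉ A})
    (hs : s.Nonempty) (Ψ : Qubits (Fin N)) (hΨ : ‖Ψ‖ = 1) :
    -- both localizable entanglements are maxima over the local measurements
    IsGreatest (localAverages A (concentratableEntanglement s) Ψ)
        (localizableEntanglement A (concentratableEntanglement s) Ψ) ∧
    IsGreatest (localAverages A (sqrtCE s) Ψ) (localizableEntanglement A (sqrtCE s) Ψ) ∧
    -- the two inequalities
    localizableEntanglement A (sqrtCE s) Ψ ≤
        √(localizableEntanglement A (concentratableEntanglement s) Ψ) ∧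
    (1 / 2) * maxCorrelation Ψ (Subtype.val '' (s : Set {i : Fin N // i ∉ A})) ≤
        localizableEntanglement A (sqrtCE s) Ψ ∧
    -- the maximum over the directions is the largest singular value of the correlation matrix
    (∀ i ∈ s, ∀ j ∈ s, i ≠ j →
      IsGreatest (pairCorrelations Ψ i j) (maxSingularValue (correlationMatrix Ψ i j))) ∧
    -- the maximum on the right-hand side exists and is the one for an optimal pair
    (s.Nontrivial →
      IsGreatest (allCorrelations Ψ (Subtype.val '' (s : Set {i : Fin N // i ∉ A})))
        (maxCorrelation Ψ (Subtype.val '' (s : Set {i : Fin N // i ∉ A}))) ∧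
      ∃ i ∈ s, ∃ j ∈ s, i ≠ j ∧
        maxCorrelation Ψ (Subtype.val '' (s : Set {i : Fin N // i ∉ A})) =
          maxSingularValue (correlationMatrix Ψ i j)) := by
  have hpair : ∀ r ∈ allCorrelations Ψ (Subtype.val '' (s : Set {i : Fin N // i ∉ A})),
      1 / 2 * r ≤ localizableEntanglement A (sqrtCE s) Ψ := by
    rintro r ⟨_, ⟨i, hi, rfl⟩, _, ⟨j, hj, rfl⟩, hij, a, b, ha, hb, rfl⟩
    exact half_abs_spinCorrelation_le A s Ψ hΨ hi (fun h => hij (congrArg _ h)) ha hb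
  have hmax : s.Nontrivial → ∃ i ∈ s, ∃ j ∈ s, i ≠ j ∧
      IsGreatest (allCorrelations Ψ (Subtype.val '' (s : Set {i : Fin N // i ∉ A})))
        (maxSingularValue (correlationMatrix Ψ i j)) := by
    intro hnt
    obtain ⟨_, ⟨i, hi, rfl⟩, _, ⟨j, hj, rfl⟩, hij, h⟩ := exists_isGreatest_allCorrelations Ψ
      (Set.Nontrivial.image (Finset.nontrivial_coe.2 hnt) Subtype.val_injective)
    exact ⟨i, hi, j, hj, fun h => hij (congrArg _ h), h⟩
  refine ⟨isGreatest_localizableEntanglement A (continuous_concentratableEntanglement s) Ψ,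
    isGreatest_localizableEntanglement A (continuous_sqrtCE s) Ψ,
    localizableEntanglement_sqrtCE_le A s Ψ hΨ, ?_, ?_, ?_⟩
  · rcases (allCorrelations Ψ (Subtype.val '' (s : Set {i : Fin N // i ∉ A}))).eq_empty_or_nonempty
      with h | h
    · rw [maxCorrelation, h, Real.sSup_empty, mul_zero]
      obtain ⟨e, -, hr⟩ := (isGreatest_localizableEntanglement A (continuous_sqrtCE s) Ψ).1
      rw [hr]
      exact Finset.sum_nonneg fun k _ => mul_nonneg (by positivity) (Real.sqrt_nonneg _)
    · have : maxCorrelation Ψ (Subtype.val '' (s : Set {i : Fin N // i ∉ A})) ≤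
          2 * localizableEntanglement A (sqrtCE s) Ψ :=
        csSup_le h fun r hr => by linarith [hpair r hr]
      linarith
  · exact fun i _ j _ hij => isGreatest_pairCorrelations Ψ fun h => hij (Subtype.ext h)
  · intro hnt
    obtain ⟨i, hi, j, hj, hij, h⟩ := hmax hnt
    have heq := h.csSup_eq
    refine ⟨?_, i, hi, j, hj, hij, heq⟩
    rw [maxCorrelation, heq]
    exact h
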